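/- \begin{theorem} Let $\Box$ be the category whose objects are the posets $[1]^n=\{0\le 1\}^n$, $n\ge 0$, and whose maps are generated under composition by the faces, the degeneracies, and both the negative (max) and the positive (min) connections. A cubical set is a presheaf $X$ of sets on $\Box$; $\Box^n$ denotes the representable presheaf of $[1]^n$, with faces $\partial_{i,\varepsilon}$ ($1\le i\le n$, $\varepsilon=0,1$); $\partial\Box^n\subseteq\Box^n$ is the union of the images of all faces, and open boxes are the unions of the images of all faces but one. A Kan complex is a cubical set $X$ for which $X\to\Box^0$ has the right lifting property against all open box inclusions. Let $\otimes$ be the geometric product of cubical sets, i.e. the left Kan extension of $([1]^m,[1]^n)\mapsto\Box^{m+n}$. For pointed cubical sets, $[(A,a),(X,x)]_*$ is the set of pointed maps modulo the equivalence relation generated by pointed homotopy, where a pointed homotopy from $f$ to $g$ is a map $A\otimes\Box^1\to X$ restricting to $f$ and $g$ at the ends $0$ and $1$ and constant at $x$ on $a\otimes\Box^1$. For a pointed cubical set $(X,x)$ let $\Omega(X,x)$ be the cubical set whose $n$-cubes are the $(n+1)$-cubes of $X$ whose $\partial_{1,0}$- and $\partial_{1,1}$-faces are degenerate at $x$ (operators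 act through the last $n$ coordinates), pointed at the degenerate $1$-cube at $x$. Let $\Omega^n$ be its $n$-fold iterate and $\pi_n(X,x)=\pi_0(\Omega^n(X,x))$, where $\pi_0$ of a cubical set is its colimit as a diagram of sets. A $0$-cube $u$ of $\Omega^n(X,x)$ is the same as a map $\Box^n\to X$ sending $\partial\Box^n$ to $x$, i.e. a pointed map $\bar u\colon(\Box^n/\partial\Box^n,[0])\to(X,x)$, where $[0]$ is the point given by the collapsed boundary (a disjoint point if $n=0$). Finally let $0$ be the vertex $(0,\dots,0)$ of $\partial\Box^{n+1}$, and let $q\colon(\partial\Box^{n+1},0)\to(\Box^n/\partial\Box^n,[0])$ be the map that is the quotient map on the face $\partial_{n+1,1}$ and constant at $[0]$ on all other faces. Then, for every $n\ge 0$ and every pointed Kan complex $(X,x)$: \begin{enumerate} \item the assignment $[u]\mapsto[\bar u\circ q]$ is a well-defined bijection \[\Phi_{(X,x)}\colon\pi_n(X,x)\to[(\partial\Box^{n+1},0),(X,x)]_*,\] natural in $(X,x)$ with respect to pointed maps of pointed Kan complexes; \item for every pointed map $f\colon(\partial\Box^{n+1},0)\to(X,x)$, the element $\Phi_{(X,x)}^{-1}([f])$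 is the class of the $n$-cube degenerate at $x$ if and only if $f$ has a filler, that is, extends along $\partial\Box^{n+1}\subseteq\Box^{n+1}$ to a map $\Box^{n+1}\to X$. \end{enumerate} \end{theorem} -/

import Mathlib

open CategoryTheory Opposite

universe u

/-! ### The cube category -/

/-- Vertices of the `n`-cube, i.e. elements of the poset `[1]^n = {0 ≤ 1}^n`. -/
abbrev BVec (n : ℕ) : Type := Fin n → Bool

/-- The face map `∂_{i,ε} : [1]^n → [1]^(n+1)`, inserting `ε` at position `i`
(positions are counted from `0`). -/
def faceFun {n : ℕ} (i : Fin (n + 1)) (ε : Bool) (x : BVec n) : BVec (n + 1) :=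
  Fin.insertNth (α := fun _ => Bool) i ε x

/-- The degeneracy `σ_i : [1]^(n+1) → [1]^n`, deleting the coordinate at position `i`. -/
def degFun {n : ℕ} (i : Fin (n + 1)) (x : BVec (n + 1)) : BVec n :=
  fun j => x (i.succAbove j)

/-- The connection `γ_{i,ε} : [1]^(n+2) → [1]^(n+1)`, replacing the coordinates at positions
`i, i+1` by their maximum (`ε = 0`, negative connection) or minimum (`ε = 1`, positive
connection). -/
def connFun {n : ℕ} (i : Fin (n + 1)) (ε : Bool) (x : BVec (n + 2)) : BVec (n + 1) :=
  fun j =>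
    if j < i then x j.castSucc
    else if j = i then
      (if ε then x i.castSucc ⊓ x i.succ else x i.castSucc ⊔ x i.succ)
    else x j.succ

/-- The maps `[1]^m → [1]^n` generated under composition by faces, degeneracies and both kinds
of connections. -/
inductive IsBoxMap : ∀ {m n : ℕ}, (BVec m → BVec n) → Prop
  | id (n : ℕ) : IsBoxMap (fun x : BVec n => x)
  | face {n : ℕ} (i : Fin (n + 1)) (ε : Bool) : IsBoxMap (faceFun i ε)
  | deg {n : ℕ} (i : Fin (n + 1)) : IsBoxMap (degFun i)
  | conn {n : ℕ} (i : Fin (n + 1)) (ε : Bool) : IsBoxMap (connFun i ε)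
  | comp {l m n : ℕ} {f : BVec l → BVec m} {g : BVec m → BVec n} :
      IsBoxMap f → IsBoxMap g → IsBoxMap (fun x => g (f x))

theorem IsBoxMap.of_eq {m n : ℕ} {f g : BVec m → BVec n} (hf : IsBoxMap f)
    (h : ∀ x j, f x j = g x j) : IsBoxMap g :=
  (funext fun x => funext fun j => h x j : f = g) ▸ hf

theorem faceFun_same {n : ℕ} (i : Fin (n + 1)) (ε : Bool) (x : BVec n) :
    faceFun i ε x i = ε := by simp [faceFun]

theorem faceFun_succAbove {n : ℕ} (i : Fin (n + 1)) (ε : Bool) (x : BVec n) (j : Fin n) :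
    faceFun i ε x (i.succAbove j) = x j := by simp [faceFun]

theorem IsBoxMap.of_face {n : ℕ} (i : Fin (n + 1)) (ε : Bool) {g : BVec n → BVec (n + 1)}
    (h : ∀ x, g x i = ε) (h' : ∀ x j, g x (i.succAbove j) = x j) : IsBoxMap g := by
  refine (IsBoxMap.face i ε).of_eq fun x j => ?_
  induction j using Fin.succAboveCases i with
  | x => rw [faceFun_same, h]
  | p j => rw [faceFun_succAbove, h']

/-- Objects of the cube category: `⟨n⟩` stands for the poset `[1]^n`. -/
structure Box : Type where
  dim : ℕ

namespace Box

/-- Morphisms of the cube category. -/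
@[ext]
structure Hom (a b : Box) : Type where
  toFun : BVec a.dim → BVec b.dim
  isBoxMap : IsBoxMap toFun

instance : Category Box where
  Hom := Hom
  id a := ⟨fun x => x, .id a.dim⟩
  comp f g := ⟨fun x => g.toFun (f.toFun x), .comp f.isBoxMap g.isBoxMap⟩

@[ext]
theorem hom_ext {a b : Box} {f g : a ⟶ b} (h : ∀ x j, f.toFun x j = g.toFun x j) : f = g :=
  Hom.ext (funext fun x => funext fun j => h x j)

@[simp] theorem id_toFun (a : Box) (x : BVec a.dim) : (𝟙 a : a ⟶ a).toFun x = x := rfl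

@[simp] theorem comp_toFun {a b c : Box} (f : a ⟶ b) (g : b ⟶ c) (x : BVec a.dim) :
    (f ≫ g).toFun x = g.toFun (f.toFun x) := rfl

/-- The face map as a morphism of the cube category. -/
def face {n : ℕ} (i : Fin (n + 1)) (ε : Bool) : (⟨n⟩ : Box) ⟶ ⟨n + 1⟩ := ⟨_, .face i ε⟩

/-- The degeneracy as a morphism of the cube category. -/
def deg {n : ℕ} (i : Fin (n + 1)) : (⟨n + 1⟩ : Box) ⟶ ⟨n⟩ := ⟨_, .deg i⟩

@[simp] theorem face_toFun {n : ℕ} (i : Fin (n + 1)) (ε : Bool) (x : BVec n) :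
    (face i ε).toFun x = faceFun i ε x := rfl

@[simp] theorem deg_toFun {n : ℕ} (i : Fin (n + 1)) (x : BVec (n + 1)) :
    (deg i).toFun x = degFun i x := rfl

/-- The unique morphism `[1]^n → [1]^0`, a composite of degeneracies. -/
def toZero : ∀ n : ℕ, (⟨n⟩ : Box) ⟶ ⟨0⟩
  | 0 => 𝟙 _
  | n + 1 => deg 0 ≫ toZero n

/-- The vertex `(0, …, 0)` of `[1]^n`, a composite of faces `∂_{i,0}`. -/
def zeroVertex : ∀ n : ℕ, (⟨0⟩ : Box) ⟶ ⟨n⟩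
  | 0 => 𝟙 _
  | n + 1 => zeroVertex n ≫ face 0 false

theorem hom_zero_ext {a : Box} (f g : a ⟶ ⟨0⟩) : f = g :=
  hom_ext fun _ j => Fin.elim0 j

theorem zeroVertex_apply (n : ℕ) (x : BVec 0) (j : Fin n) :
    (zeroVertex n).toFun x j = false := by
  induction n with
  | zero => exact Fin.elim0 j
  | succ n ih =>
    refine Fin.cases ?_ (fun k => ?_) j
    · simp [zeroVertex, faceFun]
    · simpa [zeroVertex, faceFun] using ih k

/-! #### The monoidal structure -/

/-- `id ⊗ f : [1]^(1+m) → [1]^(1+n)`, with `1 + m` written as `m + 1`: the new coordinate is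
the first one. -/
def consFun {m n : ℕ} (f : BVec m → BVec n) (x : BVec (m + 1)) : BVec (n + 1) :=
  Fin.cons (α := fun _ => Bool) (x 0) (f (fun j => x j.succ))

theorem consFun_isBoxMap {m n : ℕ} {f : BVec m → BVec n} (h : IsBoxMap f) :
    IsBoxMap (consFun f) := by
  induction h with
  | id n =>
    refine (IsBoxMap.id (n + 1)).of_eq fun x j => ?_
    cases j using Fin.cases <;> simp [consFun]
  | face i ε =>
    refine IsBoxMap.of_face i.succ ε (fun x => ?_) fun x j => ?_
    · simp [consFun, faceFun_same]
    · cases j using Fin.cases <;> simp [consFun, faceFun_succAbove]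
  | deg i =>
    refine (IsBoxMap.deg i.succ).of_eq fun x j => ?_
    cases j using Fin.cases <;> simp [consFun, degFun]
  | conn i ε =>
    refine (IsBoxMap.conn i.succ ε).of_eq fun x j => ?_
    cases j using Fin.cases <;> simp [consFun, connFun]
  | comp hf hg ihf ihg =>
    refine (ihf.comp ihg).of_eq fun x j => ?_
    cases j using Fin.cases <;> simp [consFun]


/-- `f ⊗ g : [1]^(m+k) → [1]^(m'+k')`. -/
def tensorFun {m m' k k' : ℕ} (f : BVec m → BVec m') (g : BVec k → BVec k')
    (x : BVec (m + k)) : BVec (m' + k') :=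
  Fin.append (f fun j => x (Fin.castAdd k j)) (g fun j => x (Fin.natAdd m j))

theorem snocFun_isBoxMap {m n : ℕ} {f : BVec m → BVec n} (h : IsBoxMap f) :
    IsBoxMap (fun x : BVec (m + 1) =>
      Fin.snoc (α := fun _ => Bool) (f fun j => x j.castSucc) (x (Fin.last m))) := by
  induction h with
  | id n =>
    refine (IsBoxMap.id (n + 1)).of_eq fun x j => ?_
    cases j using Fin.lastCases <;> simp
  | @face n i ε =>
    refine IsBoxMap.of_face i.castSucc ε (fun x => ?_) fun x j => ?_
    · simp [faceFun_same]
    · cases j using Fin.lastCases with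
      | last =>
        have h1 : i.castSucc.succAbove (Fin.last n) = Fin.last (n + 1) := by
          rw [Fin.succAbove_of_le_castSucc]
          · simp
          · simp [Fin.le_iff_val_le_val]; omega
        simp [h1]
      | cast j => simp [faceFun_succAbove]
  | @deg n i =>
    refine (IsBoxMap.deg i.castSucc).of_eq fun x j => ?_
    cases j using Fin.lastCases with
    | last => simp [degFun]
    | cast j => simp [degFun]
  | @conn n i ε =>
    refine (IsBoxMap.conn i.castSucc ε).of_eq fun x j => ?_
    cases j using Fin.lastCases with
    | last =>
      have h1 : ¬ Fin.last (n + 1) < i.castSucc := by simp [Fin.lt_def]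
      have h2 : ¬ Fin.last (n + 1) = i.castSucc := by simp [Fin.ext_iff]; omega
      simp only [connFun, if_neg h1, if_neg h2, Fin.snoc_last, Fin.succ_last]
    | cast j => simp [connFun]
  | comp hf hg ihf ihg =>
    refine (ihf.comp ihg).of_eq fun x j => ?_
    cases j using Fin.lastCases <;> simp

theorem natAdd_succAbove_castAdd {m n : ℕ} (i : Fin (n + 1)) (j : Fin m) :
    Fin.succAbove (n := m + n) (Fin.natAdd m i) (Fin.castAdd n j) = Fin.castAdd (n + 1) j := by
  rw [Fin.succAbove_of_castSucc_lt]
  · rfl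
  · simp [Fin.lt_def]; omega

theorem natAdd_succAbove_natAdd {m n : ℕ} (i : Fin (n + 1)) (j : Fin n) :
    Fin.succAbove (n := m + n) (Fin.natAdd m i) (Fin.natAdd m j) =
      Fin.natAdd m (i.succAbove j) := by
  simp only [Fin.succAbove, Fin.lt_def]
  split_ifs <;> simp_all [Fin.ext_iff] <;> omega

theorem tensor_id_left {k k' : ℕ} (m : ℕ) {g : BVec k → BVec k'} (h : IsBoxMap g) :
    IsBoxMap (tensorFun (fun x : BVec m => x) g) := by
  induction h with
  | id n =>
    refine (IsBoxMap.id (m + n)).of_eq fun x j => ?_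
    cases j using Fin.addCases <;> simp [tensorFun]
  | @face n i ε =>
    refine IsBoxMap.of_face (n := m + n) (Fin.natAdd m i) ε (fun x => ?_) fun x j => ?_
    · simp [tensorFun, faceFun_same]
    · cases j using Fin.addCases with
      | left j => rw [natAdd_succAbove_castAdd]; simp [tensorFun]
      | right j => rw [natAdd_succAbove_natAdd]; simp [tensorFun, faceFun_succAbove]
  | @deg n i =>
    refine (IsBoxMap.deg (n := m + n) (Fin.natAdd m i)).of_eq fun x j => ?_
    cases j using Fin.addCases with
    | left j =>
      simp only [degFun, natAdd_succAbove_castAdd, tensorFun, Fin.append_left]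
    | right j => simp only [degFun, natAdd_succAbove_natAdd, tensorFun, Fin.append_right]
  | @conn n i ε =>
    refine (IsBoxMap.conn (n := m + n) (Fin.natAdd m i) ε).of_eq fun x j => ?_
    cases j using Fin.addCases (m := m) (n := n + 1) with
    | left j =>
      have h1 : Fin.castAdd (n + 1) j < Fin.natAdd m i := by simp [Fin.lt_def]; omega
      simp only [connFun, tensorFun, Fin.append_left]
      rw [if_pos h1]; rfl
    | right j =>
      have h1 : Fin.natAdd m j < Fin.natAdd m i ↔ j < i := by simp
      have h2 : Fin.natAdd m j = Fin.natAdd m i ↔ j = i := by simp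
      simp only [connFun, tensorFun, Fin.append_right]
      simp only [← h1, ← h2]
      rfl
  | comp hf hg ihf ihg =>
    refine (ihf.comp ihg).of_eq fun x j => ?_
    cases j using Fin.addCases <;> simp [tensorFun]

theorem tensor_id_right {m m' : ℕ} {f : BVec m → BVec m'} (h : IsBoxMap f) (k : ℕ) :
    IsBoxMap (tensorFun f (fun x : BVec k => x)) := by
  induction k with
  | zero =>
    refine h.of_eq fun x j => ?_
    exact (Fin.append_left (f x) (fun j : Fin 0 => x (Fin.natAdd m j)) j).symm
  | succ k ih =>
    refine (snocFun_isBoxMap ih).of_eq fun x j => ?_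
    cases j using Fin.addCases (m := m') (n := k + 1) with
    | left j =>
      have : Fin.castAdd (k+1) j = (Fin.castAdd k j).castSucc := rfl
      simp only [tensorFun, Fin.append_left]
      rw [this, Fin.snoc_castSucc, Fin.append_left]; rfl
    | right j =>
      simp only [tensorFun, Fin.append_right]
      cases j using Fin.lastCases with
      | last =>
        have : Fin.natAdd m' (Fin.last k) = Fin.last (m' + k) := rfl
        rw [this, Fin.snoc_last]; rfl
      | cast j =>
        have : Fin.natAdd m' j.castSucc = (Fin.natAdd m' j).castSucc := rfl
        rw [this, Fin.snoc_castSucc, Fin.append_right]; rfl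

theorem tensorFun_isBoxMap {m m' k k' : ℕ} {f : BVec m → BVec m'} {g : BVec k → BVec k'}
    (hf : IsBoxMap f) (hg : IsBoxMap g) : IsBoxMap (tensorFun f g) := by
  refine ((tensor_id_left m hg).comp (tensor_id_right hf k')).of_eq fun x j => ?_
  cases j using Fin.addCases <;> simp [tensorFun]

end Box

/-- `id_{[1]^1} ⊗ f` as a morphism of the cube category. -/
def Box.cons {m n : ℕ} (f : (⟨m⟩ : Box) ⟶ ⟨n⟩) : (⟨m + 1⟩ : Box) ⟶ ⟨n + 1⟩ :=
  ⟨Box.consFun f.toFun, Box.consFun_isBoxMap f.isBoxMap⟩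

/-- The monoidal product `f ⊗ g` of two morphisms of the cube category. -/
def Box.tensor {m m' k k' : ℕ} (f : (⟨m⟩ : Box) ⟶ ⟨m'⟩) (g : (⟨k⟩ : Box) ⟶ ⟨k'⟩) :
    (⟨m + k⟩ : Box) ⟶ ⟨m' + k'⟩ :=
  ⟨Box.tensorFun f.toFun g.toFun, Box.tensorFun_isBoxMap f.isBoxMap g.isBoxMap⟩

theorem Box.cons_id (n : ℕ) : Box.cons (𝟙 (⟨n⟩ : Box)) = 𝟙 _ := by
  ext x j
  cases j using Fin.cases <;> simp [Box.cons, Box.consFun]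

theorem Box.cons_comp {l m n : ℕ} (f : (⟨l⟩ : Box) ⟶ ⟨m⟩) (g : (⟨m⟩ : Box) ⟶ ⟨n⟩) :
    Box.cons (f ≫ g) = Box.cons f ≫ Box.cons g := by
  ext x j
  cases j using Fin.cases <;> simp [Box.cons, Box.consFun]

theorem Box.face_zero_cons {m n : ℕ} (f : (⟨m⟩ : Box) ⟶ ⟨n⟩) (ε : Bool) :
    Box.face 0 ε ≫ Box.cons f = f ≫ Box.face 0 ε := by
  ext x j
  cases j using Fin.cases <;> simp [Box.cons, Box.consFun, faceFun]

theorem Box.face_succ {n : ℕ} (i : Fin (n + 1)) (ε : Bool) :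
    Box.face i.succ ε = Box.cons (Box.face i ε) := by
  ext x j
  induction j using Fin.succAboveCases i.succ with
  | x => simp [Box.cons, Box.consFun, faceFun_same]
  | p j =>
    refine (faceFun_succAbove i.succ ε x j).trans ?_
    cases j using Fin.cases <;> simp [Box.cons, Box.consFun, faceFun_succAbove]

theorem Box.tensor_id_zero {m n : ℕ} (f : (⟨m⟩ : Box) ⟶ ⟨n⟩) :
    Box.tensor f (𝟙 (⟨0⟩ : Box)) = f := by
  ext x j
  exact Fin.append_left (f.toFun x) (fun j : Fin 0 => x (Fin.natAdd m j)) j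

/-! ### Cubical sets -/

/-- Cubical sets: presheaves on the cube category. -/
abbrev CSet : Type (u + 1) := Boxᵒᵖ ⥤ Type u

namespace CSet

/-- The set `X_n` of `n`-cubes of `X`. -/
abbrev cells (X : CSet.{u}) (n : ℕ) : Type u := X.obj (op ⟨n⟩)

/-- The right action of cubical operators on cubes. -/
abbrev act (X : CSet.{u}) {m n : ℕ} (x : X.cells n) (f : (⟨m⟩ : Box) ⟶ ⟨n⟩) : X.cells m :=
  X.map f.op x

theorem act_act (X : CSet.{u}) {l m n : ℕ} (x : X.cells n) (f : (⟨m⟩ : Box) ⟶ ⟨n⟩)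
    (g : (⟨l⟩ : Box) ⟶ ⟨m⟩) : X.act (X.act x f) g = X.act x (g ≫ f) := by
  simp [act]

theorem act_id (X : CSet.{u}) {n : ℕ} (x : X.cells n) : X.act x (𝟙 _) = x := by
  simp [act]

/-- The `n`-cube `x σ … σ` degenerate at a `0`-cube `x`. -/
def const (X : CSet.{u}) (x : X.cells 0) (n : ℕ) : X.cells n := X.act x (Box.toZero n)

theorem const_act (X : CSet.{u}) (x : X.cells 0) {m n : ℕ} (f : (⟨m⟩ : Box) ⟶ ⟨n⟩) :
    X.act (X.const x n) f = X.const x m := by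
  rw [const, act_act, const, Box.hom_zero_ext (f ≫ Box.toZero n) (Box.toZero m)]

theorem const_zero (X : CSet.{u}) (x : X.cells 0) : X.const x 0 = x := X.act_id x

theorem naturality_act {X Y : CSet.{u}} (f : X ⟶ Y) {m n : ℕ} (x : X.cells n)
    (g : (⟨m⟩ : Box) ⟶ ⟨n⟩) : f.app _ (X.act x g) = Y.act (f.app _ x) g :=
  NatTrans.naturality_apply f g.op x

theorem naturality_const {X Y : CSet.{u}} (f : X ⟶ Y) (x : X.cells 0) (n : ℕ) :
    f.app _ (X.const x n) = Y.const (f.app _ x) n :=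
  naturality_act f x _

/-- The combinatorial `n`-cube `□^n`, represented by `[1]^n`. -/
abbrev cube (n : ℕ) : CSet.{u} where
  obj p := ULift.{u} (p.unop ⟶ (⟨n⟩ : Box))
  map f := TypeCat.ofHom fun g => ULift.up (f.unop ≫ g.down)
  map_id _ := rfl
  map_comp _ _ := rfl

/-- The map `□^n → X` classified by an `n`-cube of `X`. -/
def cubeMap {X : CSet.{u}} {n : ℕ} (x : X.cells n) : cube.{u} n ⟶ X where
  app p := TypeCat.ofHom fun g => X.act x g.down
  naturality p q f := by
    ext g
    exact (X.act_act x g.down f.unop).symm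

theorem cubeMap_comp {X Y : CSet.{u}} {n : ℕ} (x : X.cells n) (f : X ⟶ Y) :
    cubeMap x ≫ f = cubeMap (f.app _ x) := by
  ext p g
  exact naturality_act f x g.down

/-- The unique map to the terminal cubical set `□^0`. -/
def toPoint (X : CSet.{u}) : X ⟶ cube.{u} 0 where
  app p := TypeCat.ofHom fun _ => ULift.up (Box.toZero p.unop.dim)
  naturality p q f := by
    refine ConcreteCategory.hom_ext _ _ fun x => ?_
    exact congrArg ULift.up (Box.hom_zero_ext _ _)

/-- The image of the face map `∂_{i,ε} : □^n → □^(n+1)`. -/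
def faceImage {n : ℕ} (i : Fin (n + 1)) (ε : Bool) : Subfunctor (cube.{u} (n + 1)) :=
  Subfunctor.range (cubeMap.{u} (X := cube (n + 1)) (ULift.up (Box.face i ε)))

/-- The boundary `∂□^n ⊆ □^n`, the union of the images of all faces (empty for `n = 0`). -/
def boundary : ∀ n : ℕ, Subfunctor (cube.{u} n)
  | 0 => ⊥
  | _ + 1 => ⨆ i, ⨆ ε, faceImage i ε

/-- The `(i,ε)` open box in `□^(n+1)`, the union of the images of all faces but one. -/
def openBox {n : ℕ} (i : Fin (n + 1)) (ε : Bool) : Subfunctor (cube.{u} (n + 1)) :=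
  ⨆ j, ⨆ η, ⨆ _ : (j, η) ≠ (i, ε), faceImage j η

theorem mem_faceImage {n : ℕ} (i : Fin (n + 1)) (ε : Bool) (p : Boxᵒᵖ)
    (f : (cube.{u} (n + 1)).obj p) :
    f ∈ (faceImage i ε).obj p ↔ ∀ v, f.down.toFun v i = ε := by
  constructor
  · rintro ⟨g, rfl⟩ v
    exact faceFun_same i ε _
  · intro h
    refine ⟨ULift.up (f.down ≫ Box.deg i), ?_⟩
    refine congrArg ULift.up (Box.hom_ext fun v j => ?_)
    change faceFun i ε (degFun i (f.down.toFun v)) j = f.down.toFun v j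
    induction j using Fin.succAboveCases i with
    | x => rw [faceFun_same, h]
    | p j => rw [faceFun_succAbove]; rfl

theorem mem_boundary : ∀ (n : ℕ) (p : Boxᵒᵖ) (f : (cube.{u} n).obj p),
    f ∈ (boundary n).obj p ↔ ∃ i ε, ∀ v, f.down.toFun v i = ε
  | 0, p, f => by
    simp only [boundary, Subfunctor.bot_obj]
    exact ⟨fun h => h.elim, fun ⟨i, _⟩ => Fin.elim0 i⟩
  | n + 1, p, f => by
    simp only [boundary, Subfunctor.iSup_obj, Set.mem_iUnion]
    exact exists_congr fun i => exists_congr fun ε => mem_faceImage i ε p f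

/-- Kan fibrations: maps with the right lifting property against all open box inclusions. -/
def IsKanFibration {X Y : CSet.{u}} (p : X ⟶ Y) : Prop :=
  ∀ (n : ℕ) (i : Fin (n + 1)) (ε : Bool), HasLiftingProperty (openBox.{u} i ε).ι p

/-- Kan complexes. -/
def IsKan (X : CSet.{u}) : Prop := IsKanFibration X.toPoint

/-! #### The geometric product -/

/-- Representatives of `p`-cubes of `X ⊗ Y`: an `m`-cube `x` of `X`, a `k`-cube `y` of `Y` and
an operator `[1]^p → [1]^(m+k)`. -/
structure GeomPre (X Y : CSet.{u}) (p : Box) : Type u where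
  m : ℕ
  k : ℕ
  x : X.cells m
  y : Y.cells k
  op : p ⟶ ⟨m + k⟩

/-- The relations `(x φ, y ψ, θ) ∼ (x, y, (φ ⊗ ψ) θ)` of the coend formula. -/
inductive GeomRel (X Y : CSet.{u}) (p : Box) : GeomPre X Y p → GeomPre X Y p → Prop
  | mk {m m' k k' : ℕ} (φ : (⟨m⟩ : Box) ⟶ ⟨m'⟩) (ψ : (⟨k⟩ : Box) ⟶ ⟨k'⟩)
      (x : X.cells m') (y : Y.cells k') (θ : p ⟶ ⟨m + k⟩) :
      GeomRel X Y p ⟨m, k, X.act x φ, Y.act y ψ, θ⟩ ⟨m', k', x, y, θ ≫ Box.tensor φ ψ⟩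

/-- The geometric product `X ⊗ Y`, the left Kan extension of `([1]^m, [1]^k) ↦ □^(m+k)` along
the Yoneda embedding, given by the coend
`(X ⊗ Y)_p = ∫^{m,k} X_m × Y_k × Box([1]^p, [1]^(m+k))`. -/
def geomProd (X Y : CSet.{u}) : CSet.{u} where
  obj p := Quot (GeomRel X Y p.unop)
  map f := TypeCat.ofHom (Quot.map (fun c => ⟨c.m, c.k, c.x, c.y, f.unop ≫ c.op⟩) (by
    rintro _ _ ⟨φ, ψ, x, y, θ⟩
    have h := GeomRel.mk φ ψ x y (f.unop ≫ θ)
    rwa [Category.assoc] at h))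
  map_id p := by
    ext ⟨c⟩
    exact congrArg (Quot.mk _) (by simp)
  map_comp f g := by
    ext ⟨c⟩
    exact congrArg (Quot.mk _) (by simp)

/-- Functoriality `f ⊗ Y : X ⊗ Y → X' ⊗ Y` of the geometric product in the first variable. -/
def geomProdMap {X X' : CSet.{u}} (f : X ⟶ X') (Y : CSet.{u}) : geomProd X Y ⟶ geomProd X' Y where
  app p := TypeCat.ofHom (Quot.map (fun c => ⟨c.m, c.k, f.app _ c.x, c.y, c.op⟩) (by
    rintro _ _ ⟨φ, ψ, x, y, θ⟩
    have h := GeomRel.mk φ ψ (f.app _ x) y θ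
    rwa [← naturality_act] at h))
  naturality p q g := by
    ext ⟨c⟩
    rfl

/-- The end inclusion `X ⊗ ∂_{1,ε} : X ≅ X ⊗ □^0 → X ⊗ □^1`, `x ↦ x ⊗ ε`. -/
def cylEnd (X : CSet.{u}) (ε : Bool) : X ⟶ geomProd X (cube.{u} 1) where
  app p := TypeCat.ofHom fun x =>
    Quot.mk _ ⟨p.unop.dim, 0, x, ULift.up (Box.face 0 ε), 𝟙 p.unop⟩
  naturality p q f := by
    ext x
    have h := GeomRel.mk (X := X) (Y := cube.{u} 1) (p := q.unop) f.unop (𝟙 (⟨0⟩ : Box)) x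
      (ULift.up (Box.face 0 ε)) (𝟙 q.unop)
    rw [Box.tensor_id_zero] at h
    exact Quot.sound h

/-- Relative homotopy between maps of pairs `f g : (X, A) → (Y, B)`, where the pairs are given
by maps `i : A → X` and `j : B → Y`: a map `H : X ⊗ □^1 → Y` from `f` to `g` whose restriction
to `A ⊗ □^1` factors through `B`. -/
def RelHomotopic {A X B Y : CSet.{u}} (i : A ⟶ X) (j : B ⟶ Y) (f g : X ⟶ Y) : Prop :=
  ∃ H : geomProd X (cube.{u} 1) ⟶ Y,
    X.cylEnd false ≫ H = f ∧ X.cylEnd true ≫ H = g ∧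
      ∃ K : geomProd A (cube.{u} 1) ⟶ B, geomProdMap i (cube.{u} 1) ≫ H = K ≫ j

/-- The set `π_0(X)` of connected components: the colimit of `X` as a diagram of sets. -/
noncomputable def pi0 (X : CSet.{u}) : Type u := Limits.colimit X

/-- The connected component of a `0`-cube. -/
noncomputable def pi0Mk (X : CSet.{u}) (x : X.cells 0) : X.pi0 := Limits.colimit.ι X (op ⟨0⟩) x

/-- Functoriality of `π_0`. -/
noncomputable def pi0Map {X Y : CSet.{u}} (f : X ⟶ Y) : X.pi0 → Y.pi0 :=
  fun c => Limits.colimMap f c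

end CSet

/-! ### Pointed cubical sets -/

/-- Pointed cubical sets. -/
structure PtCSet : Type (u + 1) where
  toCSet : CSet.{u}
  pt : toCSet.cells 0

namespace PtCSet

/-- Pointed maps. -/
@[ext]
structure Hom (X Y : PtCSet.{u}) : Type u where
  map : X.toCSet ⟶ Y.toCSet
  map_pt : map.app _ X.pt = Y.pt

instance : Category PtCSet.{u} where
  Hom := Hom
  id X := ⟨𝟙 X.toCSet, rfl⟩
  comp f g := ⟨f.map ≫ g.map, by
    change g.map.app _ (f.map.app _ _) = _
    rw [f.map_pt, g.map_pt]⟩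

@[ext]
theorem hom_ext {X Y : PtCSet.{u}} {f g : X ⟶ Y} (h : f.map = g.map) : f = g := Hom.ext h

/-- The base point as a map `□^0 → X`. -/
abbrev ptMap (X : PtCSet.{u}) : CSet.cube.{u} 0 ⟶ X.toCSet := CSet.cubeMap X.pt

/-- The constant pointed map at the base point. -/
def constMap (X Y : PtCSet.{u}) : X ⟶ Y :=
  ⟨X.toCSet.toPoint ≫ Y.ptMap, Y.toCSet.act_id _⟩

/-- Pointed homotopy: homotopy relative to the base points. -/
def Homotopic {X Y : PtCSet.{u}} (f g : X ⟶ Y) : Prop :=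
  CSet.RelHomotopic X.ptMap Y.ptMap f.map g.map

/-- The set `[X, Y]_*` of pointed homotopy classes of pointed maps: the quotient by the
equivalence relation generated by pointed homotopy. -/
def Classes (X Y : PtCSet.{u}) : Type u := Quot (Homotopic (X := X) (Y := Y))

/-- The pointed homotopy class of a pointed map. -/
def classOf {X Y : PtCSet.{u}} (f : X ⟶ Y) : Classes X Y := Quot.mk _ f

/-- Postcomposition `[A, X]_* → [A, Y]_*` with a pointed map `X → Y`. -/
def Classes.map (A : PtCSet.{u}) {X Y : PtCSet.{u}} (f : X ⟶ Y) : Classes A X → Classes A Y :=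
  Quot.map (fun g => g ≫ f) (by
    rintro g h ⟨H, h0, h1, K, hK⟩
    refine ⟨H ≫ f.map, ?_, ?_, K, ?_⟩
    · rw [← Category.assoc, h0]; rfl
    · rw [← Category.assoc, h1]; rfl
    · rw [← Category.assoc, hK, Category.assoc]
      rw [ptMap, CSet.cubeMap_comp, f.map_pt])

/-! #### Loop spaces and homotopy groups -/

/-- The underlying cubical set of the (right) loop space `Ω(X, x)`: the right hom
`rhom(□^1, X)` has as `n`-cubes the maps `□^1 ⊗ □^n = □^(1+n) → X`, with operators `f` acting
through `id ⊗ f`, and `Ω(X, x)` consists of those whose two faces in the first direction are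
degenerate at `x`. -/
def loopCSet (X : PtCSet.{u}) : CSet.{u} where
  obj p := { c : X.toCSet.cells (p.unop.dim + 1) //
    ∀ ε, X.toCSet.act c (Box.face 0 ε) = X.toCSet.const X.pt p.unop.dim }
  map {p q} f := TypeCat.ofHom fun c => ⟨X.toCSet.act c.1 (Box.cons f.unop), fun ε => by
    rw [CSet.act_act, Box.face_zero_cons, ← CSet.act_act, c.2, CSet.const_act]⟩
  map_id p := by
    refine ConcreteCategory.hom_ext _ _ fun c => Subtype.ext ?_
    change X.toCSet.act c.1 (Box.cons (𝟙 _)) = c.1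
    rw [Box.cons_id]
    exact X.toCSet.act_id c.1
  map_comp f g := by
    refine ConcreteCategory.hom_ext _ _ fun c => Subtype.ext ?_
    change X.toCSet.act c.1 (Box.cons (g.unop ≫ f.unop)) =
      X.toCSet.act (X.toCSet.act c.1 (Box.cons f.unop)) (Box.cons g.unop)
    rw [CSet.act_act, Box.cons_comp]

/-- The loop space functor `Ω` on pointed cubical sets; the base point of `Ω(X, x)` is the
degenerate `1`-cube `x σ_1`. -/
def loop : PtCSet.{u} ⥤ PtCSet.{u} where
  obj X := ⟨X.loopCSet, ⟨X.toCSet.const X.pt 1, fun _ => CSet.const_act _ _ _⟩⟩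
  map {X Y} f := ⟨
    { app := fun p => TypeCat.ofHom fun c => ⟨f.map.app _ c.1, fun ε => by
        rw [← CSet.naturality_act, c.2, CSet.naturality_const, f.map_pt]⟩
      naturality := fun p q g => by
        ext c
        exact Subtype.ext (CSet.naturality_act f.map c.1 (Box.cons g.unop)) },
    Subtype.ext ((CSet.naturality_const f.map X.pt 1).trans (by rw [f.map_pt]))⟩
  map_id X := rfl
  map_comp f g := rfl

/-- The `n`-fold loop space functor, `Ω^0 = id` and `Ω^(n+1) = Ω^n ∘ Ω`
(which is also `Ω ∘ Ω^n`). -/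
def iterLoop : ℕ → (PtCSet.{u} ⥤ PtCSet.{u})
  | 0 => 𝟭 _
  | n + 1 => loop ⋙ iterLoop n

theorem iterLoop_succ' (n : ℕ) : iterLoop.{u} (n + 1) = iterLoop n ⋙ loop := by
  induction n with
  | zero => rfl
  | succ n ih =>
    change loop ⋙ iterLoop (n + 1) = loop ⋙ (iterLoop n ⋙ loop)
    rw [ih]

/-- The underlying set of the `n`-th homotopy group, `π_n(X, x) = π_0(Ω^n(X, x))`. -/
noncomputable def homotopyGroup (n : ℕ) (X : PtCSet.{u}) : Type u :=
  ((iterLoop n).obj X).toCSet.pi0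

/-- The class in `π_n(X, x)` of a `0`-cube of `Ω^n(X, x)`. -/
noncomputable def homotopyGroupMk (n : ℕ) (X : PtCSet.{u})
    (a : ((iterLoop n).obj X).toCSet.cells 0) : homotopyGroup n X :=
  CSet.pi0Mk _ a

/-- The map `π_n(X, x) → π_n(Y, y)` induced by a pointed map. -/
noncomputable def homotopyGroupMap (n : ℕ) {X Y : PtCSet.{u}} (f : X ⟶ Y) :
    homotopyGroup n X → homotopyGroup n Y :=
  CSet.pi0Map ((iterLoop n).map f).map

/-- The `n`-cube of `X` corresponding to a `0`-cube of `Ω^n(X, x)`: a `0`-cube of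
`Ω^n(Ω(X, x))` gives an `n`-cube of `Ω(X, x)`, which is an `(n+1)`-cube of `X`. -/
def loopCube : ∀ (n : ℕ) (X : PtCSet.{u}),
    ((iterLoop n).obj X).toCSet.cells 0 → X.toCSet.cells n
  | 0, _ => fun a => a
  | n + 1, X => fun a => (loopCube n (loop.obj X) a).1

theorem loop_const_val (X : PtCSet.{u}) (n : ℕ) :
    ((loop.obj X).toCSet.const (loop.obj X).pt n).1 =
      X.toCSet.const X.pt (n + 1) :=
  CSet.const_act _ _ _

/-- The `n`-cube corresponding to the base point of `Ω^n(X, x)` is degenerate at `x`. -/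
theorem loopCube_pt : ∀ (n : ℕ) (X : PtCSet.{u}),
    loopCube n X ((iterLoop n).obj X).pt = X.toCSet.const X.pt n
  | 0, X => (X.toCSet.const_zero X.pt).symm
  | n + 1, X => (congrArg Subtype.val (loopCube_pt n (loop.obj X))).trans (loop_const_val X n)

/-- The faces of the cube corresponding to a `0`-cube of `Ω^n(X, x)` are degenerate at `x`. -/
theorem loopCube_face : ∀ (n : ℕ) (X : PtCSet.{u})
    (a : ((iterLoop (n + 1)).obj X).toCSet.cells 0) (i : Fin (n + 1)) (ε : Bool),
    X.toCSet.act (loopCube (n + 1) X a) (Box.face i ε) = X.toCSet.const X.pt n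
  | n, X, a, i, ε => by
    induction i using Fin.cases with
    | zero => exact (loopCube n (loop.obj X) a).2 ε
    | succ j =>
      cases n with
      | zero => exact Fin.elim0 j
      | succ n =>
        rw [Box.face_succ, ← loop_const_val]
        exact congrArg Subtype.val (loopCube_face n (loop.obj X) a j ε)

/-! #### Cubes modulo their boundary -/

/-- The quotient `□^n / ∂□^n`, the pushout of `□^0 ← ∂□^n → □^n`. -/
noncomputable def cubeQuot (n : ℕ) : CSet.{u} :=
  Limits.pushout (CSet.toPoint (CSet.boundary.{u} n).toFunctor) (CSet.boundary.{u} n).ι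

/-- The collapsed boundary `[0] : □^0 → □^n / ∂□^n`. -/
noncomputable def cubeQuotPt (n : ℕ) : CSet.cube.{u} 0 ⟶ cubeQuot.{u} n :=
  Limits.pushout.inl _ _

/-- The quotient map `[id] : □^n → □^n / ∂□^n`. -/
noncomputable def cubeQuotMk (n : ℕ) : CSet.cube.{u} n ⟶ cubeQuot.{u} n :=
  Limits.pushout.inr _ _

/-- `□^n / ∂□^n` pointed at `[0]`. -/
noncomputable def ptCubeQuot (n : ℕ) : PtCSet.{u} :=
  ⟨cubeQuot n, (cubeQuotPt n).app _ (ULift.up (𝟙 _))⟩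

theorem cubeQuot_condition (n : ℕ) (p : Boxᵒᵖ) (f : (CSet.cube.{u} n).obj p)
    (h : f ∈ (CSet.boundary.{u} n).obj p) :
    (cubeQuotMk n).app p f = (cubeQuotPt n).app p (ULift.up (Box.toZero _)) :=
  (ConcreteCategory.congr_hom (NatTrans.congr_app (Limits.pushout.condition
    (f := (CSet.toPoint (CSet.boundary.{u} n).toFunctor)) (g := (CSet.boundary.{u} n).ι)) p)
      ⟨f, h⟩).symm

theorem quotMapOfLoop_aux (n : ℕ) (X : PtCSet.{u})
    (a : ((iterLoop n).obj X).toCSet.cells 0) :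
    CSet.toPoint (CSet.boundary.{u} n).toFunctor ≫ X.ptMap =
      (CSet.boundary.{u} n).ι ≫ CSet.cubeMap (loopCube n X a) := by
  refine NatTrans.ext (funext fun p => ConcreteCategory.hom_ext _ _ fun ⟨f, hf⟩ => ?_)
  cases n with
  | zero => exact hf.elim
  | succ n =>
    simp only [CSet.boundary, Subfunctor.iSup_obj, Set.mem_iUnion] at hf
    obtain ⟨i, ε, g, rfl⟩ := hf
    change X.toCSet.const X.pt p.unop.dim =
      X.toCSet.act (loopCube (n + 1) X a) (g.down ≫ Box.face i ε)
    rw [← CSet.act_act, loopCube_face, CSet.const_act]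

/-- The pointed map `□^n / ∂□^n → X` corresponding to a `0`-cube of `Ω^n(X, x)`. -/
noncomputable def quotMapOfLoop (n : ℕ) (X : PtCSet.{u})
    (a : ((iterLoop n).obj X).toCSet.cells 0) : ptCubeQuot.{u} n ⟶ X :=
  ⟨Limits.pushout.desc X.ptMap (CSet.cubeMap (loopCube n X a)) (quotMapOfLoop_aux n X a), by
    have h := Limits.pushout.inl_desc (f := CSet.toPoint (CSet.boundary.{u} n).toFunctor)
      (g := (CSet.boundary.{u} n).ι) X.ptMap (CSet.cubeMap (loopCube n X a))
      (quotMapOfLoop_aux n X a)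
    exact (ConcreteCategory.congr_hom (NatTrans.congr_app h (op ⟨0⟩))
      (ULift.up (𝟙 _) : (CSet.cube.{u} 0).obj (op ⟨0⟩))).trans
      (X.toCSet.act_id X.pt)⟩

/-- The boundary `∂□^(n+1)`, pointed at the vertex `0 = (0, …, 0)`. -/
def ptBoundary (n : ℕ) : PtCSet.{u} :=
  ⟨(CSet.boundary.{u} (n + 1)).toFunctor, ⟨ULift.up (Box.zeroVertex _),
    (CSet.mem_boundary _ _ _).2 ⟨0, false, fun v => Box.zeroVertex_apply _ v 0⟩⟩⟩

open Classical in
/-- The map `∂□^(n+1) → □^n / ∂□^n` which is `[id]` on the face `∂_{n+1,1}` and `[0]` on all the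
other faces, on cubes: a cube of the face `∂_{n+1,1}` (last coordinate constantly `1`) goes to
the class of its first `n` coordinates, any other cube of the boundary to the base point. -/
noncomputable def collapseApp (n : ℕ) (p : Boxᵒᵖ) (f : (CSet.cube.{u} (n + 1)).obj p) :
    (cubeQuot.{u} n).obj p :=
  if f ∈ (CSet.faceImage (Fin.last n) true).obj p then
    (cubeQuotMk n).app p (ULift.up (f.down ≫ Box.deg (Fin.last n)))
  else (cubeQuotPt n).app p (ULift.up (Box.toZero _))

theorem collapseApp_of_mem_face (n : ℕ) (p : Boxᵒᵖ) (f : (CSet.cube.{u} (n + 1)).obj p)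
    (h : f ∈ (CSet.faceImage (Fin.last n) true).obj p) :
    collapseApp n p f = (cubeQuotMk n).app p (ULift.up (f.down ≫ Box.deg (Fin.last n))) :=
  if_pos h

theorem collapseApp_of_mem (n : ℕ) (p : Boxᵒᵖ) (f : (CSet.cube.{u} (n + 1)).obj p)
    (h : f ∈ (CSet.openBox (Fin.last n) true).obj p) :
    collapseApp n p f = (cubeQuotPt n).app p (ULift.up (Box.toZero _)) := by
  unfold collapseApp
  split_ifs with h'
  · refine cubeQuot_condition n p _ ((CSet.mem_boundary _ _ _).2 ?_)
    simp only [CSet.openBox, Subfunctor.iSup_obj, Set.mem_iUnion] at h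
    obtain ⟨j, η, hne, h⟩ := h
    rw [CSet.mem_faceImage] at h h'
    induction j using Fin.lastCases with
    | last =>
      refine absurd ?_ hne
      have := (h fun _ => false).symm.trans (h' _)
      rw [this]
    | cast j =>
      refine ⟨j, η, fun v => ?_⟩
      change f.down.toFun v ((Fin.last n).succAbove j) = η
      rw [Fin.succAbove_last_apply, h]
  · rfl

theorem mem_boundary_cases (n : ℕ) (p : Boxᵒᵖ) (f : (CSet.cube.{u} (n + 1)).obj p)
    (h : f ∈ (CSet.boundary (n + 1)).obj p) :
    f ∈ (CSet.faceImage (Fin.last n) true).obj p ∨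
      f ∈ (CSet.openBox (Fin.last n) true).obj p := by
  simp only [CSet.boundary, CSet.openBox, Subfunctor.iSup_obj, Set.mem_iUnion] at h ⊢
  obtain ⟨j, η, h⟩ := h
  by_cases hj : (j, η) = (Fin.last n, true)
  · obtain ⟨rfl, rfl⟩ := Prod.ext_iff.1 hj
    exact Or.inl h
  · exact Or.inr ⟨j, η, hj, h⟩

/-- The pointed map `∂□^(n+1) → □^n / ∂□^n` which is `[id]` on the face `∂_{n+1,1}` and `[0]` on
all the other faces. -/
noncomputable def collapse (n : ℕ) : ptBoundary.{u} n ⟶ ptCubeQuot.{u} n :=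
  ⟨{  app := fun p => TypeCat.ofHom fun f => collapseApp n p f.1
      naturality := fun p q g => by
        ext ⟨f, hf⟩
        change collapseApp n q ((CSet.cube (n + 1)).map g f) =
          (cubeQuot n).map g (collapseApp n p f)
        rcases mem_boundary_cases n p f hf with h | h
        · have h' := (CSet.faceImage (Fin.last n) true).map g h
          rw [collapseApp_of_mem_face n p f h]
          exact (collapseApp_of_mem_face n q _ h').trans
            (NatTrans.naturality_apply (cubeQuotMk.{u} n) g
              (ULift.up (f.down ≫ Box.deg (Fin.last n)) : (CSet.cube.{u} n).obj p))
        · have h' := (CSet.openBox (Fin.last n) true).map g h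
          rw [collapseApp_of_mem n p f h]
          refine (collapseApp_of_mem n q _ h').trans
            (Eq.trans ?_ (NatTrans.naturality_apply (cubeQuotPt n) g _))
          exact congrArg _ (congrArg ULift.up (Box.hom_zero_ext _ _)) }, by
    refine (if_neg ?_ : collapseApp n _ _ = _).trans ?_
    · rw [CSet.mem_faceImage]
      intro h
      have := (Box.zeroVertex_apply (n + 1) (fun _ => false) (Fin.last n)).symm.trans (h _)
      exact Bool.noConfusion this
    · rfl⟩

/-- `collapse` restricts to `[id]` on the face `∂_{n+1,1}`. -/
theorem collapse_face (n : ℕ) (p : Boxᵒᵖ) (f : (CSet.cube.{u} n).obj p) (h) :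
    (collapse.{u} n).map.app p ⟨ULift.up (f.down ≫ Box.face (Fin.last n) true), h⟩ =
      (cubeQuotMk n).app p f := by
  refine (if_pos ((CSet.mem_faceImage _ _ _ _).2 fun v => faceFun_same _ _ _) :
    collapseApp n _ _ = _).trans (congrArg _ (congrArg ULift.up ?_))
  refine Box.hom_ext fun v j => ?_
  exact faceFun_succAbove _ _ _ j

/-- The pointed map `∂□^(n+1) → X` corresponding to a `0`-cube of `Ω^n(X, x)`. -/
noncomputable def boundaryMapOfLoop (n : ℕ) (X : PtCSet.{u})
    (a : ((iterLoop n).obj X).toCSet.cells 0) : ptBoundary.{u} n ⟶ X :=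
  collapse n ≫ quotMapOfLoop n X a

/-- A filler of `f : ∂□^(n+1) → X` is an extension of `f` along `∂□^(n+1) ⊆ □^(n+1)`. -/
def HasFiller {n : ℕ} {X : PtCSet.{u}} (f : ptBoundary.{u} n ⟶ X) : Prop :=
  ∃ F : CSet.cube.{u} (n + 1) ⟶ X.toCSet, (CSet.boundary.{u} (n + 1)).ι ≫ F = f.map

end PtCSet

/-! Coordinates of [1]^(n+1) are written x_0, …, x_n. A map `f` from ∂□^(n+1) to a Kan complex
amounts to two cubes (`IsGlued`): an (n+1)-cube `F` that agrees with `f` on the open box omitting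
the face x_n = 1, and the n-cube `h` which is `f` on that face. The maps ū ∘ q are those with `F`
constant at the base point. To invert Φ one therefore contracts `F` to the vertex 0 and drags `h`
along.

The contraction removes one coordinate at a time, the last one first. The positive connection gives
a homotopy `contract k` from `truncate k` to `truncate (k + 1)`, where `truncate k` replaces all
coordinates x_j with j ≥ k by 0. It prescribes how the boundary of `h` must move, and filling an
open box extends this motion to `h`. After n + 1 steps `F` has become constant and `h` has become a
cube with constant boundary, that is, a 0-cube `c` of Ω^n. Because fillers are chosen, this is
recorded as a relation `Represents f c`.

Three facts make the relation an inverse of Φ. Every `f` has a representative `c`, and `f` is then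
homotopic, through the successive stages, to the map given by `c` (`exists_represents`,
`Represents.classOf_eq`): this is surjectivity. A cube `c` represents its own map, by the constant
contraction (`represents_boundaryMapOfLoop`). Finally, representatives of homotopic maps agree in
π_n, whatever the choices (`homotopyGroupMk_eq_of_homotopic`): the contractions at both ends of a
homotopy extend over the homotopy by box filling one dimension higher. The last two facts give
injectivity.

Having a filler is invariant under homotopy, again by box filling. For the map of a cube `c`, a
filler is an (n+1)-cube that is constant on all faces but x_n = 1 and equals `c` there: it is itself
a path in Ω^n from the base point to `c`. -/

namespace Box

/-! ### Operators with values in faces, boundaries, open boxes and sides -/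

/-- The operator `a` takes its values in the face `(i, ε)` of the cube. -/
def OnFace {m n : ℕ} (a : (⟨m⟩ : Box) ⟶ ⟨n⟩) (i : Fin n) (ε : Bool) : Prop :=
  ∀ v, a.toFun v i = ε

theorem OnFace.precomp {l m n : ℕ} {a : (⟨m⟩ : Box) ⟶ ⟨n⟩} {i : Fin n} {ε : Bool}
    (h : OnFace a i ε) (b : (⟨l⟩ : Box) ⟶ ⟨m⟩) : OnFace (b ≫ a) i ε := fun _ => h _

theorem OnFace.unique {m n : ℕ} {a : (⟨m⟩ : Box) ⟶ ⟨n⟩} {i : Fin n} {ε η : Bool}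
    (h : OnFace a i ε) (h' : OnFace a i η) : ε = η :=
  (h fun _ => false).symm.trans (h' _)

theorem OnFace.deg_face {m n : ℕ} {a : (⟨m⟩ : Box) ⟶ ⟨n + 1⟩} {i : Fin (n + 1)} {ε : Bool}
    (h : OnFace a i ε) : (a ≫ deg i) ≫ face i ε = a := by
  refine hom_ext fun v j => ?_
  change faceFun i ε (degFun i (a.toFun v)) j = a.toFun v j
  induction j using Fin.succAboveCases i with
  | x => rw [faceFun_same, h]
  | p j => rw [faceFun_succAbove]; rfl

theorem onFace_face {n : ℕ} (i : Fin (n + 1)) (ε : Bool) : OnFace (face i ε) i ε :=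
  fun _ => faceFun_same _ _ _

theorem face_deg {n : ℕ} (i : Fin (n + 1)) (ε : Bool) : face i ε ≫ deg i = 𝟙 _ :=
  hom_ext fun v j => faceFun_succAbove i ε v j

/-- The operator `a` takes its values in the boundary of the cube. -/
def OnBoundary {m n : ℕ} (a : (⟨m⟩ : Box) ⟶ ⟨n⟩) : Prop := ∃ i ε, OnFace a i ε

/-- The operator `a` takes its values in the open box omitting the face `(i, ε)`. -/
def OnOpenBox {n : ℕ} (i : Fin (n + 1)) (ε : Bool) {m : ℕ} (a : (⟨m⟩ : Box) ⟶ ⟨n + 1⟩) : Prop :=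
  ∃ j η, (j, η) ≠ (i, ε) ∧ OnFace a j η

/-- The operator `a` takes its values in `∂□^n ⊗ □^1 ⊆ □^(n+1)`. -/
def OnSide {m n : ℕ} (a : (⟨m⟩ : Box) ⟶ ⟨n + 1⟩) : Prop := ∃ i : Fin n, ∃ ε, OnFace a i.castSucc ε

theorem OnBoundary.precomp {l m n : ℕ} {a : (⟨m⟩ : Box) ⟶ ⟨n⟩} (h : OnBoundary a)
    (b : (⟨l⟩ : Box) ⟶ ⟨m⟩) : OnBoundary (b ≫ a) :=
  h.imp fun _ => Exists.imp fun _ h => h.precomp b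

theorem OnOpenBox.precomp {l m n : ℕ} {i : Fin (n + 1)} {ε : Bool}
    {a : (⟨m⟩ : Box) ⟶ ⟨n + 1⟩} (h : OnOpenBox i ε a)
    (b : (⟨l⟩ : Box) ⟶ ⟨m⟩) : OnOpenBox i ε (b ≫ a) :=
  h.imp fun _ => Exists.imp fun _ h => ⟨h.1, h.2.precomp b⟩

theorem OnSide.precomp {l m n : ℕ} {a : (⟨m⟩ : Box) ⟶ ⟨n + 1⟩} (h : OnSide a)
    (b : (⟨l⟩ : Box) ⟶ ⟨m⟩) : OnSide (b ≫ a) :=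
  h.imp fun _ => Exists.imp fun _ h => h.precomp b

theorem OnOpenBox.onBoundary {m n : ℕ} {i : Fin (n + 1)} {ε : Bool}
    {a : (⟨m⟩ : Box) ⟶ ⟨n + 1⟩} (h : OnOpenBox i ε a) : OnBoundary a :=
  h.imp fun _ => Exists.imp fun _ h => h.2

theorem OnSide.onOpenBox {m n : ℕ} {a : (⟨m⟩ : Box) ⟶ ⟨n + 1⟩} (h : OnSide a) (ε : Bool) :
    OnOpenBox (Fin.last n) ε a :=
  let ⟨i, η, h⟩ := h
  ⟨i.castSucc, η, fun h => (Fin.castSucc_lt_last i).ne (congrArg Prod.fst h), h⟩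

theorem OnBoundary.cases {m n : ℕ} {a : (⟨m⟩ : Box) ⟶ ⟨n + 1⟩} (h : OnBoundary a)
    (i : Fin (n + 1)) (ε : Bool) : OnFace a i ε ∨ OnOpenBox i ε a := by
  obtain ⟨j, η, h⟩ := h
  by_cases hj : (j, η) = (i, ε)
  · obtain ⟨rfl, rfl⟩ := Prod.ext_iff.1 hj
    exact Or.inl h
  · exact Or.inr ⟨j, η, hj, h⟩

theorem deg_last_apply {n : ℕ} (v : BVec (n + 1)) (j : Fin n) :
    (deg (Fin.last n)).toFun v j = v j.castSucc :=
  congrArg v (Fin.succAbove_last_apply j)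

theorem face_last_castSucc {n : ℕ} (ε : Bool) (v : BVec n) (j : Fin n) :
    (face (Fin.last n) ε).toFun v j.castSucc = v j := by
  have := faceFun_succAbove (Fin.last n) ε v j
  rwa [Fin.succAbove_last_apply] at this

theorem face_last_last {n : ℕ} (ε : Bool) (v : BVec n) :
    (face (Fin.last n) ε).toFun v (Fin.last n) = ε := faceFun_same _ _ _

theorem OnSide.deg_last {m n : ℕ} {a : (⟨m⟩ : Box) ⟶ ⟨n + 1⟩} (h : OnSide a) :
    OnBoundary (a ≫ deg (Fin.last n)) := by
  obtain ⟨i, ε, h⟩ := h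
  exact ⟨i, ε, fun v => (deg_last_apply _ _).trans (h v)⟩

theorem OnBoundary.face_last {m n : ℕ} {a : (⟨m⟩ : Box) ⟶ ⟨n⟩} (h : OnBoundary a) (ε : Bool) :
    OnSide (a ≫ face (Fin.last n) ε) := by
  obtain ⟨i, η, h⟩ := h
  exact ⟨i, η, fun v => (face_last_castSucc _ _ _).trans (h v)⟩

/-- If the operator lies both in the open box omitting the face `(n, ε)` and in that face, then it
lies on the side. -/
theorem OnOpenBox.onSide {m n : ℕ} {ε : Bool} {a : (⟨m⟩ : Box) ⟶ ⟨n + 1⟩}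
    (h : OnOpenBox (Fin.last n) ε a) (h' : OnFace a (Fin.last n) ε) : OnSide a := by
  obtain ⟨j, η, hne, h⟩ := h
  induction j using Fin.lastCases with
  | last => exact absurd (by rw [h.unique h']) hne
  | cast j => exact ⟨j, η, h⟩

end Box

/-! ### Partial cubes and open box filling -/

namespace CSet

/-- A partially defined `N`-cube of `X`: a compatible assignment of cubes of `X` to some of the
operators with values in `[1]^N`. -/
structure PartialCube (X : CSet.{u}) (N : ℕ) where
  rel : ∀ {m : ℕ}, ((⟨m⟩ : Box) ⟶ ⟨N⟩) → X.cells m → Prop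
  functional : ∀ {m : ℕ} {a : (⟨m⟩ : Box) ⟶ ⟨N⟩} {x y : X.cells m}, rel a x → rel a y → x = y
  stable : ∀ {l m : ℕ} {a : (⟨m⟩ : Box) ⟶ ⟨N⟩} {x : X.cells m}, rel a x →
    ∀ b : (⟨l⟩ : Box) ⟶ ⟨m⟩, rel (b ≫ a) (X.act x b)

/-- Values may be chosen arbitrarily: since `rel` is functional, the choices are unique, and
stability then makes them natural. Maps out of unions of faces can thus be given by overlapping
cases. -/
theorem PartialCube.exists_map {X : CSet.{u}} {N : ℕ} (R : PartialCube X N)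
    (S : Subfunctor (cube.{u} N))
    (hS : ∀ (m : ℕ) (a : (⟨m⟩ : Box) ⟶ ⟨N⟩), ULift.up a ∈ S.obj (op ⟨m⟩) → ∃ x, R.rel a x) :
    ∃ φ : S.toFunctor ⟶ X, ∀ (m : ℕ) (a : (⟨m⟩ : Box) ⟶ ⟨N⟩) (ha : ULift.up a ∈ S.obj (op ⟨m⟩)),
      R.rel a (φ.app (op ⟨m⟩) ⟨ULift.up a, ha⟩) := by
  choose c hc using hS
  refine ⟨{ app := fun p => TypeCat.ofHom fun f => c p.unop.dim f.1.down f.2,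
            naturality := fun p q g => ?_ }, fun m a ha => hc m a ha⟩
  refine ConcreteCategory.hom_ext _ _ fun f => ?_
  exact R.functional (hc _ _ _) (R.stable (hc p.unop.dim f.1.down f.2) g.unop)

theorem mem_openBox {n : ℕ} (i : Fin (n + 1)) (ε : Bool) {m : ℕ} (a : (⟨m⟩ : Box) ⟶ ⟨n + 1⟩) :
    (ULift.up a : (cube.{u} (n + 1)).obj (op ⟨m⟩)) ∈ (openBox i ε).obj (op ⟨m⟩) ↔
      Box.OnOpenBox i ε a := by
  simp only [openBox, Subfunctor.iSup_obj, Set.mem_iUnion]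
  exact exists_congr fun j => exists_congr fun η =>
    exists_prop.trans (and_congr_right fun _ => mem_faceImage j η _ _)

/-- In a Kan complex, open boxes of cubes have fillers. -/
theorem IsKan.fill_map {X : CSet.{u}} (hX : IsKan X) {n : ℕ} (i : Fin (n + 1)) (ε : Bool)
    (φ : (openBox.{u} i ε).toFunctor ⟶ X) :
    ∃ w : X.cells (n + 1), ∀ (m : ℕ) (a : (⟨m⟩ : Box) ⟶ ⟨n + 1⟩) (ha),
      X.act w a = φ.app (op ⟨m⟩) ⟨ULift.up a, ha⟩ := by
  have := hX n i ε
  have sq : CommSq φ (openBox.{u} i ε).ι X.toPoint (cube (n + 1)).toPoint := ⟨by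
    refine NatTrans.ext (funext fun p => ConcreteCategory.hom_ext _ _ fun f => ?_)
    exact congrArg ULift.up (Box.hom_zero_ext _ _)⟩
  have hl := sq.fac_left
  refine ⟨sq.lift.app (op ⟨n + 1⟩) (ULift.up (𝟙 _)), fun m a ha => ?_⟩
  have h1 := ConcreteCategory.congr_hom (NatTrans.congr_app hl (op ⟨m⟩)) ⟨ULift.up a, ha⟩
  refine Eq.trans ?_ h1
  refine (naturality_act sq.lift (ULift.up (𝟙 (⟨n + 1⟩ : Box)) : (cube.{u} (n + 1)).cells (n + 1))
    a).symm.trans ?_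
  exact congrArg (sq.lift.app _) (congrArg ULift.up (Category.comp_id a))

theorem IsKan.fill {X : CSet.{u}} (hX : IsKan X) {n : ℕ} (i : Fin (n + 1)) (ε : Bool)
    (R : PartialCube X (n + 1))
    (hR : ∀ (m : ℕ) (a : (⟨m⟩ : Box) ⟶ ⟨n + 1⟩), Box.OnOpenBox i ε a → ∃ x, R.rel a x) :
    ∃ w : X.cells (n + 1), ∀ (m : ℕ) (a : (⟨m⟩ : Box) ⟶ ⟨n + 1⟩), Box.OnOpenBox i ε a →
      ∀ x, R.rel a x → X.act w a = x := by
  obtain ⟨φ, hφ⟩ := R.exists_map (openBox i ε) fun m a ha => hR m a ((mem_openBox i ε a).1 ha)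
  obtain ⟨w, hw⟩ := hX.fill_map i ε φ
  exact ⟨w, fun m a ha x hx => (hw m a ((mem_openBox i ε a).2 ha)).trans
    (R.functional (hφ m a _) hx)⟩

/-! #### Connected components -/

/-- Both classes equal the image of the 1-cube itself in the colimit. -/
theorem pi0Mk_eq_of_path (X : CSet.{u}) (c : X.cells 1) :
    X.pi0Mk (X.act c (Box.face 0 false)) = X.pi0Mk (X.act c (Box.face 0 true)) :=
  (ConcreteCategory.congr_hom (Limits.colimit.w X (Box.face 0 false).op) c).trans
    (ConcreteCategory.congr_hom (Limits.colimit.w X (Box.face 0 true).op) c).symm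

theorem pi0Mk_surjective (X : CSet.{u}) : Function.Surjective X.pi0Mk := by
  intro c
  obtain ⟨p, x, rfl⟩ := Limits.Types.jointly_surjective' c
  exact ⟨X.act x (Box.zeroVertex p.unop.dim),
    ConcreteCategory.congr_hom (Limits.colimit.w X (Box.zeroVertex p.unop.dim).op) x⟩

theorem pi0Map_pi0Mk {X Y : CSet.{u}} (f : X ⟶ Y) (x : X.cells 0) :
    pi0Map f (X.pi0Mk x) = Y.pi0Mk (f.app _ x) :=
  ConcreteCategory.congr_hom (Limits.ι_colimMap f (op ⟨0⟩)) x

/-- Any vertex of a cube is joined to the zero vertex by edges of the cube, changing one coordinate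
at a time; induction on the dimension. -/
theorem apply_vertex_eq {X : CSet.{u}} {α : Type*} (g : X.cells 0 → α)
    (hg : ∀ c : X.cells 1, g (X.act c (Box.face 0 false)) = g (X.act c (Box.face 0 true))) :
    ∀ (n : ℕ) (x : X.cells n) (v : (⟨0⟩ : Box) ⟶ ⟨n⟩),
      g (X.act x v) = g (X.act x (Box.zeroVertex n))
  | 0, x, v => by rw [Box.hom_zero_ext v (Box.zeroVertex 0)]
  | n + 1, x, v => by
    have hv : Box.OnFace v 0 (v.toFun Fin.elim0 0) := fun w => by rw [Subsingleton.elim w]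
    generalize v.toFun Fin.elim0 0 = ε at hv
    have key : g (X.act x ((v ≫ Box.deg 0) ≫ Box.face 0 ε)) =
        g (X.act x ((v ≫ Box.deg 0) ≫ Box.face 0 false)) := by
      cases ε with
      | false => rfl
      | true =>
        -- This 1-cube is the edge of `x` through `v` in the first direction.
        have := hg (X.act x (Box.cons (v ≫ Box.deg 0)))
        rw [act_act, act_act, Box.face_zero_cons, Box.face_zero_cons] at this
        exact this.symm
    rw [hv.deg_face, ← act_act, apply_vertex_eq g hg n] at key
    rw [key, act_act, Box.zeroVertex]

/-- Functions on `0`-cubes that are invariant along `1`-cubes descend to `π_0`. -/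
theorem exists_pi0_desc {X : CSet.{u}} {α : Type u} (g : X.cells 0 → α)
    (hg : ∀ c : X.cells 1, g (X.act c (Box.face 0 false)) = g (X.act c (Box.face 0 true))) :
    ∃ G : X.pi0 → α, ∀ x, G (X.pi0Mk x) = g x := by
  let s : Limits.Cocone X :=
    { pt := α
      ι :=
        { app := fun p => TypeCat.ofHom fun x => g (X.act x (Box.zeroVertex p.unop.dim))
          naturality := fun p q f => by
            refine ConcreteCategory.hom_ext _ _ fun x => ?_
            refine (congrArg g (X.act_act x f.unop (Box.zeroVertex _))).trans ?_
            exact apply_vertex_eq g hg p.unop.dim x _ } }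
  refine ⟨fun c => Limits.colimit.desc X s c, fun x => ?_⟩
  refine (ConcreteCategory.congr_hom (Limits.colimit.ι_desc s (op ⟨0⟩)) x).trans ?_
  exact congrArg g (X.act_id x)

end CSet

/-! ### Operators `f ⊗ id` and substitution of constants for coordinates -/

namespace Box

/-- The operator `f ⊗ id_{[1]^1}`. -/
def snoc {m n : ℕ} (f : (⟨m⟩ : Box) ⟶ ⟨n⟩) : (⟨m + 1⟩ : Box) ⟶ ⟨n + 1⟩ :=
  Box.tensor f (𝟙 (⟨1⟩ : Box))

theorem tensor_castSucc {m m' k : ℕ} (f : (⟨m⟩ : Box) ⟶ ⟨m'⟩) (g : (⟨k⟩ : Box) ⟶ ⟨1⟩)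
    (v : BVec (m + k)) (j : Fin m') :
    (Box.tensor f g).toFun v (j.castSucc : Fin (m' + 1)) =
      f.toFun (fun i => v (Fin.castAdd k i)) j :=
  Fin.append_left _ _ j

theorem snoc_castSucc {m n : ℕ} (f : (⟨m⟩ : Box) ⟶ ⟨n⟩) (v : BVec (m + 1)) (j : Fin n) :
    (snoc f).toFun v j.castSucc = f.toFun (fun i => v i.castSucc) j :=
  Fin.append_left _ _ j

theorem snoc_last {m n : ℕ} (f : (⟨m⟩ : Box) ⟶ ⟨n⟩) (v : BVec (m + 1)) :
    (snoc f).toFun v (Fin.last n) = v (Fin.last m) :=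
  Fin.append_right (f.toFun fun i => v i.castSucc) (fun i : Fin 1 => v (Fin.natAdd m i)) 0

/-- The operator replacing the `i`-th coordinate by `ε`. -/
def setCoord {n : ℕ} (i : Fin (n + 1)) (ε : Bool) : (⟨n + 1⟩ : Box) ⟶ ⟨n + 1⟩ :=
  deg i ≫ face i ε

theorem setCoord_toFun {n : ℕ} (i : Fin (n + 1)) (ε : Bool) (v : BVec (n + 1)) :
    (setCoord i ε).toFun v = Function.update v i ε := by
  funext j
  change faceFun i ε (degFun i v) j = _
  induction j using Fin.succAboveCases i with
  | x => rw [faceFun_same, Function.update_self]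
  | p j =>
    rw [faceFun_succAbove, Function.update_of_ne (Fin.succAbove_ne i j)]
    rfl

theorem setCoord_onFace {n : ℕ} (i : Fin (n + 1)) (ε : Bool) : OnFace (setCoord i ε) i ε :=
  fun _ => faceFun_same _ _ _

theorem setCoord_comm {n : ℕ} {i j : Fin (n + 1)} (h : i ≠ j) (ε η : Bool) :
    setCoord i ε ≫ setCoord j η = setCoord j η ≫ setCoord i ε := by
  refine hom_ext fun v k => ?_
  rw [comp_toFun, comp_toFun, setCoord_toFun, setCoord_toFun, setCoord_toFun, setCoord_toFun,
    Function.update_comm h]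

theorem OnFace.comp_setCoord {m n : ℕ} {a : (⟨m⟩ : Box) ⟶ ⟨n + 1⟩} {i : Fin (n + 1)} {ε : Bool}
    (h : OnFace a i ε) : a ≫ setCoord i ε = a := by
  rw [setCoord, ← Category.assoc, h.deg_face]

theorem OnFace.comp_snoc_setCoord {m n : ℕ} {a : (⟨m⟩ : Box) ⟶ ⟨n + 2⟩} {i : Fin (n + 1)}
    {ε : Bool} (h : OnFace a i.castSucc ε) : a ≫ snoc (setCoord i ε) = a := by
  refine hom_ext fun v j => ?_
  rw [comp_toFun]
  induction j using Fin.lastCases with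
  | last => rw [snoc_last]
  | cast j =>
    rw [snoc_castSucc, setCoord_toFun]
    by_cases hj : j = i
    · subst hj; rw [Function.update_self, h]
    · rw [Function.update_of_ne hj]

end Box

/-! ### Maps out of ∂□^n and out of ∂□^n ⊗ □^1 -/

namespace CSet

/-- The cube assigned by a map out of `∂□^n` to an operator on the boundary. -/
def bdVal {X : CSet.{u}} {n : ℕ} (f : (boundary.{u} n).toFunctor ⟶ X) {m : ℕ}
    (a : (⟨m⟩ : Box) ⟶ ⟨n⟩) (ha : Box.OnBoundary a) : X.cells m :=
  f.app (op ⟨m⟩) ⟨ULift.up a, (mem_boundary n _ _).2 ha⟩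

theorem bdVal_act {X : CSet.{u}} {n : ℕ} (f : (boundary.{u} n).toFunctor ⟶ X) {l m : ℕ}
    (a : (⟨m⟩ : Box) ⟶ ⟨n⟩) (ha : Box.OnBoundary a) (b : (⟨l⟩ : Box) ⟶ ⟨m⟩) :
    X.act (bdVal f a ha) b = bdVal f (b ≫ a) (ha.precomp b) :=
  (naturality_act f _ b).symm

theorem bdVal_congr {X : CSet.{u}} {n : ℕ} (f : (boundary.{u} n).toFunctor ⟶ X) {m : ℕ}
    {a b : (⟨m⟩ : Box) ⟶ ⟨n⟩} (h : a = b) (ha : Box.OnBoundary a) (hb : Box.OnBoundary b) :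
    bdVal f a ha = bdVal f b hb := by subst h; rfl

theorem bdVal_ext {X : CSet.{u}} {n : ℕ} {f g : (boundary.{u} n).toFunctor ⟶ X}
    (h : ∀ (m : ℕ) (a : (⟨m⟩ : Box) ⟶ ⟨n⟩) (ha : Box.OnBoundary a), bdVal f a ha = bdVal g a ha) :
    f = g :=
  NatTrans.ext (funext fun p => ConcreteCategory.hom_ext _ _
    fun (x : (boundary.{u} n).toFunctor.obj p) =>
      h p.unop.dim x.1.down ((mem_boundary n p x.1).1 x.2))

/-- The subobject `∂□^n ⊗ □^1` of `□^(n+1)`. -/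
def side (n : ℕ) : Subfunctor (cube.{u} (n + 1)) where
  obj _ := {f | Box.OnSide f.down}
  map g _ h := Box.OnSide.precomp h g.unop

theorem tensor_onSide {n m k l : ℕ} {a : (⟨m⟩ : Box) ⟶ ⟨n⟩} (ha : Box.OnBoundary a)
    (b : (⟨k⟩ : Box) ⟶ ⟨1⟩) (θ : (⟨l⟩ : Box) ⟶ ⟨m + k⟩) :
    Box.OnSide (n := n) (θ ≫ Box.tensor a b) := by
  obtain ⟨i, ε, h⟩ := ha
  exact ⟨i, ε, fun v => (Box.tensor_castSucc a b _ i).trans (h _)⟩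

theorem tensor_comp {m m' m'' k k' k'' : ℕ} (φ : (⟨m⟩ : Box) ⟶ ⟨m'⟩) (ψ : (⟨k⟩ : Box) ⟶ ⟨k'⟩)
    (a : (⟨m'⟩ : Box) ⟶ ⟨m''⟩) (b : (⟨k'⟩ : Box) ⟶ ⟨k''⟩) :
    Box.tensor φ ψ ≫ Box.tensor a b = Box.tensor (φ ≫ a) (ψ ≫ b) := by
  refine Box.hom_ext fun v j => ?_
  cases j using Fin.addCases <;> simp [Box.tensor, Box.tensorFun]

/-- The canonical map from the geometric product of `∂□^n` and `□^1` to `□^(n+1)`, corestricted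
to its image. -/
def toSide (n : ℕ) :
    geomProd (boundary.{u} n).toFunctor (cube.{u} 1) ⟶ (side.{u} n).toFunctor where
  app _ := TypeCat.ofHom (Quot.lift
    (fun c => ⟨ULift.up (c.op ≫ Box.tensor c.x.1.down c.y.down),
      tensor_onSide ((mem_boundary n _ _).1 c.x.2) c.y.down c.op⟩) (by
      rintro _ _ ⟨φ, ψ, x, y, θ⟩
      refine Subtype.ext (congrArg ULift.up ?_)
      change θ ≫ Box.tensor (φ ≫ x.1.down) (ψ ≫ y.down) =
        (θ ≫ Box.tensor φ ψ) ≫ Box.tensor x.1.down y.down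
      rw [← tensor_comp, Category.assoc]))
  naturality _ _ _ := by
    refine ConcreteCategory.hom_ext _ _ ?_
    rintro ⟨c⟩
    rfl

section Cylinder

variable {X : CSet.{u}} {n : ℕ} (H : geomProd (boundary.{u} n).toFunctor (cube.{u} 1) ⟶ X)

/-- The cube assigned by a map out of `∂□^n ⊗ □^1` to the composite of `e ⊗ id` and `a`. -/
def cylVal {k m : ℕ} (e : (⟨k⟩ : Box) ⟶ ⟨n⟩) (he : Box.OnBoundary e)
    (a : (⟨m⟩ : Box) ⟶ ⟨k + 1⟩) : X.cells m :=
  H.app (op ⟨m⟩) (Quot.mk _ ⟨k, 1, ⟨ULift.up e, (mem_boundary n _ _).2 he⟩, ULift.up (𝟙 _), a⟩)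

theorem cylVal_snoc {k k' m : ℕ} (e : (⟨k⟩ : Box) ⟶ ⟨n⟩) (he : Box.OnBoundary e)
    (φ : (⟨k'⟩ : Box) ⟶ ⟨k⟩) (a : (⟨m⟩ : Box) ⟶ ⟨k' + 1⟩) :
    cylVal H e he (a ≫ Box.snoc φ) = cylVal H (φ ≫ e) (he.precomp φ) a :=
  congrArg (H.app (op ⟨m⟩)) (Quot.sound (GeomRel.mk (X := (boundary.{u} n).toFunctor)
    (Y := cube.{u} 1) φ (𝟙 (⟨1⟩ : Box)) ⟨ULift.up e, (mem_boundary n _ _).2 he⟩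
    (ULift.up (𝟙 _)) a)).symm

theorem cylVal_congr {k m : ℕ} {e e' : (⟨k⟩ : Box) ⟶ ⟨n⟩} (h : e = e') (he : Box.OnBoundary e)
    (he' : Box.OnBoundary e') (a : (⟨m⟩ : Box) ⟶ ⟨k + 1⟩) :
    cylVal H e he a = cylVal H e' he' a := by subst h; rfl

theorem cylVal_act {k l m : ℕ} (e : (⟨k⟩ : Box) ⟶ ⟨n⟩) (he : Box.OnBoundary e)
    (a : (⟨m⟩ : Box) ⟶ ⟨k + 1⟩) (b : (⟨l⟩ : Box) ⟶ ⟨m⟩) :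
    X.act (cylVal H e he a) b = cylVal H e he (b ≫ a) :=
  (naturality_act H _ b).symm

end Cylinder

theorem setCoord_onBoundary {n : ℕ} (i : Fin (n + 1)) (ε : Bool) :
    Box.OnBoundary (Box.setCoord i ε) := ⟨i, ε, Box.setCoord_onFace i ε⟩

/-- For distinct directions, both sides are the value at the intersection of the two faces, where
the two substitutions commute; by the coend relation, precomposing `e` with the other substitution
does not change the value at `a`. -/
theorem cylVal_setCoord_eq {X : CSet.{u}} {n : ℕ}
    (H : geomProd (boundary.{u} (n + 1)).toFunctor (cube.{u} 1) ⟶ X) {m : ℕ}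
    {a : (⟨m⟩ : Box) ⟶ ⟨n + 2⟩} {i j : Fin (n + 1)} {ε η : Bool}
    (hi : Box.OnFace a i.castSucc ε) (hj : Box.OnFace a j.castSucc η) :
    cylVal H _ (setCoord_onBoundary i ε) a = cylVal H _ (setCoord_onBoundary j η) a := by
  by_cases hij : i = j
  · subst hij
    rw [hi.unique hj]
  · have h1 := cylVal_snoc H _ (setCoord_onBoundary i ε) (Box.setCoord j η) a
    have h2 := cylVal_snoc H _ (setCoord_onBoundary j η) (Box.setCoord i ε) a
    rw [hj.comp_snoc_setCoord] at h1
    rw [hi.comp_snoc_setCoord] at h2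
    rw [h1, h2]
    exact cylVal_congr H (Box.setCoord_comm (Ne.symm hij) _ _) _ _ a

/-- The partial cube given by a map out of `∂□^(n+1) ⊗ □^1`. -/
def cylPartial {X : CSet.{u}} {n : ℕ}
    (H : geomProd (boundary.{u} (n + 1)).toFunctor (cube.{u} 1) ⟶ X) : PartialCube X (n + 2) where
  -- On the face (i, ε) an operator is represented by the fixed boundary cube `setCoord i ε` of
  -- dimension n + 1, so no inverse of `toSide` has to be constructed.
  rel {_} a x := ∃ i ε, Box.OnFace a (Fin.castSucc i) ε ∧
    x = cylVal H _ (setCoord_onBoundary i ε) a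
  functional := by
    rintro m a x y ⟨i, ε, hi, rfl⟩ ⟨j, η, hj, rfl⟩
    exact cylVal_setCoord_eq H hi hj
  stable := by
    rintro l m a x ⟨i, ε, hi, rfl⟩ b
    exact ⟨i, ε, hi.precomp b, cylVal_act H _ _ _ _⟩

/-- A cube `a` on the face (i, ε) equals `setCoord i ε` acted on by `a`, so one coend relation moves
an arbitrary representative to the standard one. -/
theorem cylPartial_mk {X : CSet.{u}} {n : ℕ}
    (H : geomProd (boundary.{u} (n + 1)).toFunctor (cube.{u} 1) ⟶ X) {p m k : ℕ}
    (a : (⟨m⟩ : Box) ⟶ ⟨n + 1⟩) (ha : Box.OnBoundary a) (b : (⟨k⟩ : Box) ⟶ ⟨1⟩)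
    (θ : (⟨p⟩ : Box) ⟶ ⟨m + k⟩) :
    (cylPartial H).rel (θ ≫ Box.tensor (m' := n + 1) (k' := 1) a b : (⟨p⟩ : Box) ⟶ ⟨n + 2⟩)
      (H.app (op ⟨p⟩) (Quot.mk _ ⟨m, k, ⟨ULift.up a, (mem_boundary (n + 1) _ _).2 ha⟩,
        ULift.up b, θ⟩)) := by
  obtain ⟨i, ε, h⟩ := id ha
  refine ⟨i, ε, fun v => (Box.tensor_castSucc a b _ i).trans (h _), ?_⟩
  refine congrArg (H.app (op ⟨p⟩)) ?_
  refine Eq.trans ?_ (Quot.sound (GeomRel.mk (X := (boundary.{u} (n + 1)).toFunctor)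
    (Y := cube.{u} 1) a b ⟨ULift.up (Box.setCoord i ε), (mem_boundary (n + 1) _ _).2
      (setCoord_onBoundary i ε)⟩ (ULift.up (𝟙 _)) θ))
  have h1 : (⟨ULift.up a, (mem_boundary (n + 1) _ _).2 ha⟩ :
      CSet.cells (boundary.{u} (n + 1)).toFunctor m) = CSet.act (boundary.{u} (n + 1)).toFunctor
        ⟨ULift.up (Box.setCoord i ε), (mem_boundary (n + 1) _ _).2 (setCoord_onBoundary i ε)⟩ a :=
    Subtype.ext (congrArg ULift.up h.comp_setCoord.symm)
  rw [h1]
  rfl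

end CSet

/-! ### Pointed homotopies as partial cubes of dimension n + 2 -/

namespace PtCSet

open CSet

theorem tensor_face {m n : ℕ} (a : (⟨m⟩ : Box) ⟶ ⟨n⟩) (ε : Bool) :
    (Box.tensor a (Box.face (0 : Fin 1) ε) : (⟨m⟩ : Box) ⟶ ⟨n + 1⟩) =
      a ≫ Box.face (Fin.last n) ε := by
  refine Box.hom_ext fun v j => ?_
  induction j using Fin.lastCases with
  | last =>
    rw [Box.comp_toFun, Box.face_last_last]
    exact (Fin.append_right (a.toFun v) (faceFun (0 : Fin 1) ε fun i : Fin 0 => v (Fin.natAdd m i)) 0).trans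
      (faceFun_same _ _ _)
  | cast j =>
    rw [Box.comp_toFun, Box.face_last_castSucc]
    exact Fin.append_left (a.toFun v) _ j

/-- ∂□^(n+1) ⊗ □^1 is identified with the side of □^(n+2), the last coordinate being the homotopy
parameter. This turns homotopies into partial cubes, to which box filling applies directly. -/
theorem homotopic_iff {X : PtCSet.{u}} {n : ℕ} (f g : ptBoundary n ⟶ X) :
    Homotopic f g ↔ ∃ R : PartialCube X.toCSet (n + 2),
      (∀ (m : ℕ) (a : (⟨m⟩ : Box) ⟶ ⟨n + 2⟩), Box.OnSide a → ∃ x, R.rel a x) ∧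
      (∀ (m : ℕ) (a : (⟨m⟩ : Box) ⟶ ⟨n + 1⟩) (ha : Box.OnBoundary a),
        R.rel (a ≫ Box.face (Fin.last (n + 1)) false) (bdVal f.map a ha)) ∧
      (∀ (m : ℕ) (a : (⟨m⟩ : Box) ⟶ ⟨n + 1⟩) (ha : Box.OnBoundary a),
        R.rel (a ≫ Box.face (Fin.last (n + 1)) true) (bdVal g.map a ha)) ∧
      (∀ (m : ℕ) (a : (⟨m⟩ : Box) ⟶ ⟨n + 2⟩), (∀ i : Fin (n + 1), Box.OnFace a i.castSucc false) →
        R.rel a (X.toCSet.const X.pt m)) := by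
  constructor
  · rintro ⟨H, h0, h1, K, hK⟩
    refine ⟨cylPartial H, ?_, ?_, ?_, ?_⟩
    · rintro m a ⟨i, ε, h⟩
      exact ⟨_, i, ε, h, rfl⟩
    · intro m a ha
      have h := cylPartial_mk H a ha (Box.face (0 : Fin 1) false) (𝟙 (⟨m⟩ : Box))
      rw [tensor_face] at h
      rw [← h0]
      exact h
    · intro m a ha
      have h := cylPartial_mk H a ha (Box.face (0 : Fin 1) true) (𝟙 (⟨m⟩ : Box))
      rw [tensor_face] at h
      rw [← h1]
      exact h
    · intro m a ha
      -- Such an `a` factors through the edge 0 ⊗ □^1, on which `hK` makes the homotopy constant.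
      have ha' : (a ≫ Box.snoc (Box.toZero (n + 1))) ≫ Box.snoc (Box.zeroVertex (n + 1)) = a := by
        refine Box.hom_ext fun v j => ?_
        rw [Box.comp_toFun, Box.comp_toFun]
        induction j using Fin.lastCases with
        | last => rw [Box.snoc_last, Box.snoc_last]
        | cast j => rw [Box.snoc_castSucc, Box.zeroVertex_apply, ha j v]
      have h := cylPartial_mk H (Box.zeroVertex (n + 1))
        ⟨0, false, fun v => Box.zeroVertex_apply _ v _⟩ (𝟙 (⟨1⟩ : Box))
        (a ≫ Box.snoc (Box.toZero (n + 1)))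
      change (cylPartial H).rel
        ((a ≫ Box.snoc (Box.toZero (n + 1))) ≫ Box.snoc (Box.zeroVertex (n + 1))) _ at h
      rw [ha'] at h
      have h2 := ConcreteCategory.congr_hom (NatTrans.congr_app hK (op ⟨m⟩))
        (Quot.mk _ ⟨0, 1, ULift.up (𝟙 _), ULift.up (𝟙 _), a ≫ Box.snoc (Box.toZero (n + 1))⟩)
      have h3 := h2.trans (congrArg (X.toCSet.act X.pt) (Box.hom_zero_ext _ (Box.toZero m)))
      exact (congrArg ((cylPartial H).rel a) h3).mp h
  · rintro ⟨R, ht, h0, h1, hp⟩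
    obtain ⟨φ, hφ⟩ := R.exists_map (side (n + 1)) fun m a ha => ht m a ha
    have key : ∀ (p m k : ℕ) (a : (⟨m⟩ : Box) ⟶ ⟨n + 1⟩) (ha : Box.OnBoundary a)
        (b : (⟨k⟩ : Box) ⟶ ⟨1⟩) (θ : (⟨p⟩ : Box) ⟶ ⟨m + k⟩),
        R.rel (θ ≫ Box.tensor (m' := n + 1) (k' := 1) a b : (⟨p⟩ : Box) ⟶ ⟨n + 2⟩)
          ((toSide (n + 1) ≫ φ).app (op ⟨p⟩) (Quot.mk _ ⟨m, k,
            ⟨ULift.up a, (mem_boundary (n + 1) _ _).2 ha⟩, ULift.up b, θ⟩)) :=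
      fun p m k a ha b θ => hφ p (θ ≫ Box.tensor (m' := n + 1) (k' := 1) a b) (tensor_onSide ha b θ)
    -- The restriction to the base point factors through □^0, whence the witness `toPoint`.
    refine ⟨toSide (n + 1) ≫ φ, ?_, ?_, toPoint _, ?_⟩
    · refine bdVal_ext fun m a ha => R.functional ?_ (h0 m a ha)
      have h := key m m 0 a ha (Box.face (0 : Fin 1) false) (𝟙 (⟨m⟩ : Box))
      rw [tensor_face] at h
      exact h
    · refine bdVal_ext fun m a ha => R.functional ?_ (h1 m a ha)
      have h := key m m 0 a ha (Box.face (0 : Fin 1) true) (𝟙 (⟨m⟩ : Box))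
      rw [tensor_face] at h
      exact h
    · refine NatTrans.ext (funext fun p => ConcreteCategory.hom_ext _ _ ?_)
      rintro ⟨c⟩
      have hb : Box.OnBoundary (c.x.down ≫ Box.zeroVertex (n + 1)) :=
        ⟨0, false, fun v => Box.zeroVertex_apply (n + 1) (c.x.down.toFun v) 0⟩
      refine R.functional (key p.unop.dim c.m c.k (c.x.down ≫ Box.zeroVertex (n + 1)) hb c.y.down
        c.op) (hp _ _ fun i v => ?_)
      exact (Box.tensor_castSucc _ _ _ _).trans (Box.zeroVertex_apply (n + 1) (c.x.down.toFun _) i)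

end PtCSet

/-! ### The operators that contract the cube to its zero vertex -/

namespace Box

theorem snoc_comp {l m n : ℕ} (f : (⟨l⟩ : Box) ⟶ ⟨m⟩) (g : (⟨m⟩ : Box) ⟶ ⟨n⟩) :
    snoc (f ≫ g) = snoc f ≫ snoc g := by
  refine hom_ext fun v j => ?_
  rw [comp_toFun]
  induction j using Fin.lastCases with
  | last => rw [snoc_last, snoc_last, snoc_last]
  | cast j => simp only [snoc_castSucc, comp_toFun]

theorem face_last_snoc {m n : ℕ} (f : (⟨m⟩ : Box) ⟶ ⟨n⟩) (ε : Bool) :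
    face (Fin.last m) ε ≫ snoc f = f ≫ face (Fin.last n) ε := by
  refine hom_ext fun v j => ?_
  rw [comp_toFun, comp_toFun]
  induction j using Fin.lastCases with
  | last => rw [snoc_last, face_last_last, face_last_last]
  | cast j =>
    rw [snoc_castSucc, face_last_castSucc]
    exact congrArg (fun w => f.toFun w j) (funext fun i => face_last_castSucc _ _ _)

theorem snoc_deg_last {m n : ℕ} (f : (⟨m⟩ : Box) ⟶ ⟨n⟩) :
    snoc f ≫ deg (Fin.last n) = deg (Fin.last m) ≫ f := by
  refine hom_ext fun v j => ?_
  rw [comp_toFun, deg_last_apply, snoc_castSucc, comp_toFun]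
  exact congrArg (fun w => f.toFun w j) (funext fun i => (deg_last_apply _ _).symm)

theorem OnFace.comp_snoc {l m n : ℕ} {a : (⟨l⟩ : Box) ⟶ ⟨m + 1⟩} {ε : Bool}
    (h : OnFace a (Fin.last m) ε) (f : (⟨m⟩ : Box) ⟶ ⟨n⟩) :
    a ≫ snoc f = ((a ≫ deg (Fin.last m)) ≫ f) ≫ face (Fin.last n) ε := by
  conv_lhs => rw [← h.deg_face]
  rw [Category.assoc, face_last_snoc, Category.assoc, Category.assoc, Category.assoc]

theorem OnFace.snoc_face {m n : ℕ} {a : (⟨m⟩ : Box) ⟶ ⟨n + 2⟩} {i : Fin (n + 1)}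
    {ε : Bool} (h : OnFace a i.castSucc ε) : (a ≫ snoc (deg i)) ≫ snoc (face i ε) = a := by
  rw [Category.assoc, ← snoc_comp]
  exact h.comp_snoc_setCoord

/-- The map `(x, t) ↦ (x_0, …, x_{k-1}, x_k ∧ t, 0, …, 0)`. -/
def contractFun {n : ℕ} (k : ℕ) (v : BVec (n + 2)) : BVec (n + 1) := fun j =>
  if j.val < k then v j.castSucc
  else if j.val = k then v j.castSucc ⊓ v (Fin.last (n + 1)) else false

theorem contractFun_isBoxMap (k : ℕ) : ∀ n : ℕ, IsBoxMap (contractFun (n := n) k) := by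
  have h1 (n : ℕ) (hn : n < k) : IsBoxMap (contractFun (n := n) k) := by
    -- Here `k` lies beyond all coordinates, and only the parameter t is forgotten.
    refine (IsBoxMap.deg (Fin.last (n + 1))).of_eq fun v j => ?_
    rw [contractFun, if_pos (by omega)]
    exact deg_last_apply v j
  have h2 (n : ℕ) (hn : n = k) : IsBoxMap (contractFun (n := n) k) := by
    -- Here x_k is adjacent to t, and the positive connection gives their minimum.
    refine (IsBoxMap.conn (Fin.last n) true).of_eq fun v j => ?_
    by_cases hj : j = Fin.last n
    · subst hj
      simp [contractFun, connFun, hn]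
    · have : j < Fin.last n := Fin.lt_last_iff_ne_last.2 hj
      have h3 : j.val < k := by
        rw [← hn]; exact this
      simp [contractFun, connFun, h3, this]
  intro n
  induction n with
  | zero => exact (Nat.eq_zero_or_pos k).elim (fun h => h2 0 h.symm) (h1 0)
  | succ n ih =>
    rcases lt_trichotomy (n + 1) k with h | h | h
    · exact h1 _ h
    · exact h2 _ h
    · refine (((snocFun_isBoxMap (IsBoxMap.deg (Fin.last (n + 1)))).comp ih).comp
        (IsBoxMap.face (Fin.last (n + 1)) false)).of_eq fun v j => ?_
      induction j using Fin.lastCases with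
      | last =>
        refine (faceFun_same _ _ _).trans ?_
        rw [contractFun, if_neg (by simp; omega), if_neg (by simp; omega)]
      | cast j =>
        refine (face_last_castSucc _ _ _).trans ?_
        simp only [contractFun, Fin.snoc_last, Fin.snoc_castSucc, Fin.val_castSucc]
        have : degFun (Fin.last (n + 1)) (fun j => v j.castSucc) j = v j.castSucc.castSucc :=
          deg_last_apply (fun j => v j.castSucc) j
        rw [this]

/-- The operator `(x, t) ↦ (x_0, …, x_{k-1}, x_k ∧ t, 0, …, 0)`. -/
def contract {n : ℕ} (k : ℕ) : (⟨n + 2⟩ : Box) ⟶ ⟨n + 1⟩ := ⟨_, contractFun_isBoxMap k n⟩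

/-- The operator `x ↦ (x_0, …, x_{k-1}, 0, …, 0)`. -/
def truncate {n : ℕ} (k : ℕ) : (⟨n + 1⟩ : Box) ⟶ ⟨n + 1⟩ :=
  face (Fin.last (n + 1)) false ≫ contract k

theorem truncate_apply {n : ℕ} (k : ℕ) (v : BVec (n + 1)) (j : Fin (n + 1)) :
    (truncate k).toFun v j = if j.val < k then v j else false := by
  change contractFun k ((face (Fin.last (n + 1)) false).toFun v) j = _
  simp only [contractFun, face_last_castSucc, face_last_last, Bool.min_eq_and, Bool.and_false,
    ite_self]

theorem face_true_contract {n : ℕ} (k : ℕ) :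
    face (Fin.last (n + 1)) true ≫ contract k = truncate (k + 1) := by
  refine hom_ext fun v j => ?_
  rw [truncate_apply]
  change contractFun k ((face (Fin.last (n + 1)) true).toFun v) j = _
  simp only [contractFun, face_last_castSucc, face_last_last, Bool.min_eq_and, Bool.and_true]
  split_ifs <;> first | rfl | omega

theorem truncate_of_lt {n k : ℕ} (h : n < k) : truncate (n := n) k = 𝟙 _ :=
  hom_ext fun v j => (truncate_apply k v j).trans (if_pos (by omega))

theorem truncate_zero_apply {n : ℕ} (v : BVec (n + 1)) (j : Fin (n + 1)) :
    (truncate 0).toFun v j = false := truncate_apply 0 v j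

/-- The restriction of `contract k` to the face `x_n = 1`. -/
def pinch {n : ℕ} (k : ℕ) : (⟨n + 1⟩ : Box) ⟶ ⟨n + 1⟩ :=
  snoc (face (Fin.last n) true) ≫ contract k

/-- The restriction of `truncate k` to the face `x_n = 1`. -/
def topTruncate {n : ℕ} (k : ℕ) : (⟨n⟩ : Box) ⟶ ⟨n + 1⟩ := face (Fin.last n) true ≫ truncate k

theorem face_false_pinch {n : ℕ} (k : ℕ) :
    face (Fin.last n) false ≫ pinch k = topTruncate k := by
  rw [pinch, ← Category.assoc, face_last_snoc, Category.assoc]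
  rfl

theorem face_true_pinch {n : ℕ} (k : ℕ) :
    face (Fin.last n) true ≫ pinch k = topTruncate (k + 1) := by
  rw [pinch, ← Category.assoc, face_last_snoc, Category.assoc, face_true_contract]
  rfl

end Box

/-! ### Dragging the remaining face along the contraction -/

namespace CSet

open Box

variable {X : CSet.{u}} {n : ℕ}

theorem act_of_onFace {m n : ℕ} (w : X.cells (n + 1)) {a : (⟨m⟩ : Box) ⟶ ⟨n + 1⟩}
    {i : Fin (n + 1)} {ε : Bool} (h : OnFace a i ε) :
    X.act (X.act w (face i ε)) (a ≫ deg i) = X.act w a := by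
  rw [act_act, h.deg_face]

/-- The `n`-cubes `h` and `h'` are joined by an `(n+1)`-cube `T` whose side is the contraction of
the `k`-th coordinate of `F`. -/
def ContractionStep (k : ℕ) (F : X.cells (n + 1)) (h h' : X.cells n) (T : X.cells (n + 1)) : Prop :=
  X.act T (face (Fin.last n) true) = h ∧ X.act T (face (Fin.last n) false) = h' ∧
    ∀ (m : ℕ) (a : (⟨m⟩ : Box) ⟶ ⟨n + 1⟩), OnSide a → X.act T a = X.act F (a ≫ pinch k)

/-- `u` is obtained from `h` by contracting the boundary successively along `F`. -/
def Contraction (F : X.cells (n + 1)) : ℕ → X.cells n → X.cells n → Prop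
  | 0, h, u => h = u
  | k + 1, h, u => ∃ h' T, ContractionStep k F h h' T ∧ Contraction F k h' u

/-- The boundary of `h` is the boundary of the upper face of `F`, truncated at the `k`-th
coordinate. -/
def BoundaryAgrees (k : ℕ) (F : X.cells (n + 1)) (h : X.cells n) : Prop :=
  ∀ (m : ℕ) (a : (⟨m⟩ : Box) ⟶ ⟨n⟩), OnBoundary a → X.act h a = X.act F (a ≫ topTruncate k)

theorem ContractionStep.boundaryAgrees {k : ℕ} {F : X.cells (n + 1)} {h h' : X.cells n}
    {T : X.cells (n + 1)} (hT : ContractionStep k F h h' T) : BoundaryAgrees k F h' := by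
  intro m a ha
  rw [← hT.2.1, act_act, hT.2.2 _ _ (ha.face_last false), Category.assoc, face_false_pinch]

/-- The side `pinch k` of `F` and the top face `h` form an open box, compatible because `pinch k`
ends in `topTruncate (k + 1)`. Its filler is `T`, and the missing bottom face is `h'`. -/
theorem IsKan.exists_contractionStep (hX : IsKan X) {k : ℕ} {F : X.cells (n + 1)} {h : X.cells n}
    (hh : BoundaryAgrees (k + 1) F h) : ∃ h' T, ContractionStep k F h h' T := by
  let R : PartialCube X (n + 1) :=
    { rel := fun {m} a x => (OnSide a ∧ x = X.act F (a ≫ pinch k)) ∨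
        (OnFace a (Fin.last n) true ∧ x = X.act h (a ≫ deg (Fin.last n)))
      functional := by
        have key : ∀ {m : ℕ} {a : (⟨m⟩ : Box) ⟶ ⟨n + 1⟩}, OnSide a → OnFace a (Fin.last n) true →
            X.act F (a ≫ pinch k) = X.act h (a ≫ deg (Fin.last n)) := by
          intro m a h1 h2
          rw [hh _ _ h1.deg_last, ← face_true_pinch, ← Category.assoc, h2.deg_face]
        rintro m a x y (⟨h1, rfl⟩ | ⟨h1, rfl⟩) (⟨h2, rfl⟩ | ⟨h2, rfl⟩)
        · rfl
        · exact key h1 h2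
        · exact (key h2 h1).symm
        · rfl
      stable := by
        rintro l m a x (⟨h1, rfl⟩ | ⟨h1, rfl⟩) b
        · exact Or.inl ⟨h1.precomp b, by rw [act_act, Category.assoc]⟩
        · exact Or.inr ⟨h1.precomp b, by rw [act_act, Category.assoc]⟩ }
  obtain ⟨T, hT⟩ := hX.fill (Fin.last n) false R (by
    rintro m a ⟨j, η, hne, hj⟩
    induction j using Fin.lastCases with
    | last =>
      obtain rfl : η = true := by
        by_contra h
        exact hne (by rw [Bool.eq_false_iff.2 h])
      exact ⟨_, Or.inr ⟨hj, rfl⟩⟩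
    | cast j => exact ⟨_, Or.inl ⟨⟨j, η, hj⟩, rfl⟩⟩)
  refine ⟨_, T, ?_, rfl, fun m a ha => hT m a (ha.onOpenBox _) _ (Or.inl ⟨ha, rfl⟩)⟩
  rw [hT _ _ ⟨Fin.last n, true, by simp, onFace_face _ _⟩ _ (Or.inr ⟨onFace_face _ _, rfl⟩),
    face_deg, act_id]

/-- The end of each step satisfies the compatibility needed by the next one. At stage 0 the boundary
of `u` takes its values at the zero vertex of `F`. -/
theorem IsKan.exists_contraction (hX : IsKan X) {F : X.cells (n + 1)} :
    ∀ (k : ℕ) {h : X.cells n}, BoundaryAgrees k F h →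
      ∃ u, Contraction F k h u ∧ BoundaryAgrees 0 F u
  | 0, h, hh => ⟨h, rfl, hh⟩
  | k + 1, h, hh => by
    obtain ⟨h', T, hT⟩ := hX.exists_contractionStep hh
    obtain ⟨u, hu, hu'⟩ := hX.exists_contraction k hT.boundaryAgrees
    exact ⟨u, ⟨h', T, hT, hu⟩, hu'⟩

/-- The side of `H` is the side of the upper face of `W`, truncated at the `k`-th coordinate. -/
def SideAgrees (k : ℕ) (W : X.cells (n + 2)) (H : X.cells (n + 1)) : Prop :=
  ∀ (m : ℕ) (a : (⟨m⟩ : Box) ⟶ ⟨n + 1⟩), OnSide a →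
    X.act H a = X.act W (a ≫ snoc (topTruncate k))

/-- A homotopy `H` between the cubes being contracted is carried through one step, with the steps `T
ε` at its two ends already given. -/
theorem IsKan.exists_sideAgrees_step (hX : IsKan X) {k : ℕ} {W : X.cells (n + 2)}
    {H : X.cells (n + 1)} (hH : SideAgrees (k + 1) W H) {h' : Bool → X.cells n}
    {T : Bool → X.cells (n + 1)}
    (hT : ∀ ε, ContractionStep k (X.act W (face (Fin.last (n + 1)) ε))
      (X.act H (face (Fin.last n) ε)) (h' ε) (T ε)) :
    ∃ H', SideAgrees k W H' ∧ ∀ ε, X.act H' (face (Fin.last n) ε) = h' ε := by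
  let S : ∀ {m : ℕ}, ((⟨m⟩ : Box) ⟶ ⟨n + 2⟩) → Prop :=
    fun a => ∃ i : Fin n, ∃ ε, OnFace a i.castSucc.castSucc ε
  have S_deg {m : ℕ} {a : (⟨m⟩ : Box) ⟶ ⟨n + 2⟩} (h : S a) : OnSide (a ≫ deg (Fin.last (n + 1))) := by
    obtain ⟨i, ε, h⟩ := h
    exact ⟨i, ε, fun v => (deg_last_apply _ _).trans (h v)⟩
  have S_snoc {m : ℕ} {a : (⟨m⟩ : Box) ⟶ ⟨n + 2⟩} (h : S a) :
      OnSide (a ≫ snoc (deg (Fin.last n))) := by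
    obtain ⟨i, ε, h⟩ := h
    refine ⟨i, ε, fun v => (snoc_castSucc _ _ _).trans ?_⟩
    exact (deg_last_apply _ _).trans (h v)
  have key1 {m : ℕ} {a : (⟨m⟩ : Box) ⟶ ⟨n + 2⟩} (h1 : S a)
      (h2 : OnFace a (Fin.last n).castSucc true) :
      X.act W (a ≫ snoc (pinch k)) = X.act H (a ≫ snoc (deg (Fin.last n))) := by
    rw [hH _ _ (S_snoc h1), ← face_true_pinch, snoc_comp, ← Category.assoc, h2.snoc_face]
  have key2 {m : ℕ} {a : (⟨m⟩ : Box) ⟶ ⟨n + 2⟩} {ε : Bool} (h1 : S a)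
      (h2 : OnFace a (Fin.last (n + 1)) ε) :
      X.act W (a ≫ snoc (pinch k)) = X.act (T ε) (a ≫ deg (Fin.last (n + 1))) := by
    rw [(hT ε).2.2 _ _ (S_deg h1), act_act, h2.comp_snoc]
  have key3 {m : ℕ} {a : (⟨m⟩ : Box) ⟶ ⟨n + 2⟩} {ε : Bool}
      (h1 : OnFace a (Fin.last n).castSucc true) (h2 : OnFace a (Fin.last (n + 1)) ε) :
      X.act H (a ≫ snoc (deg (Fin.last n))) = X.act (T ε) (a ≫ deg (Fin.last (n + 1))) := by
    have h3 : OnFace (a ≫ snoc (deg (Fin.last n))) (Fin.last n) ε :=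
      fun v => (snoc_last _ _).trans (h2 v)
    have h4 : OnFace (a ≫ deg (Fin.last (n + 1))) (Fin.last n) true :=
      fun v => (deg_last_apply _ _).trans (h1 v)
    rw [← act_of_onFace H h3, ← act_of_onFace (T ε) h4, (hT ε).1, Category.assoc, snoc_deg_last,
      Category.assoc]
  -- Coordinates are (x_0, …, x_{n-1}, s, t), with s the contraction parameter and t the homotopy
  -- parameter. The cube is prescribed by `W` on the faces in the directions x_i, by `H` at s = 1,
  -- and by `T ε` at t = ε.
  let R : PartialCube X (n + 2) :=
    { rel := fun {m} a x => (S a ∧ x = X.act W (a ≫ snoc (pinch k))) ∨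
        (OnFace a (Fin.last n).castSucc true ∧ x = X.act H (a ≫ snoc (deg (Fin.last n)))) ∨
        ∃ ε, OnFace a (Fin.last (n + 1)) ε ∧ x = X.act (T ε) (a ≫ deg (Fin.last (n + 1)))
      functional := by
        rintro m a x y (⟨h1, rfl⟩ | ⟨h1, rfl⟩ | ⟨ε, h1, rfl⟩) (⟨h2, rfl⟩ | ⟨h2, rfl⟩ | ⟨η, h2, rfl⟩)
        · rfl
        · exact key1 h1 h2
        · exact key2 h1 h2
        · exact (key1 h2 h1).symm
        · rfl
        · exact key3 h1 h2
        · exact (key2 h2 h1).symm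
        · exact (key3 h2 h1).symm
        · rw [h1.unique h2]
      stable := by
        rintro l m a x (⟨⟨i, ε, h1⟩, rfl⟩ | ⟨h1, rfl⟩ | ⟨ε, h1, rfl⟩) b
        · exact Or.inl ⟨⟨i, ε, h1.precomp b⟩, by rw [act_act, Category.assoc]⟩
        · exact Or.inr (Or.inl ⟨h1.precomp b, by rw [act_act, Category.assoc]⟩)
        · exact Or.inr (Or.inr ⟨ε, h1.precomp b, by rw [act_act, Category.assoc]⟩) }
  obtain ⟨w, hw⟩ := hX.fill (Fin.last n).castSucc false R (by
    rintro m a ⟨j, η, hne, hj⟩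
    induction j using Fin.lastCases with
    | last => exact ⟨_, Or.inr (Or.inr ⟨η, hj, rfl⟩)⟩
    | cast j =>
      induction j using Fin.lastCases with
      | last =>
        obtain rfl : η = true := by
          by_contra h
          exact hne (by rw [Bool.eq_false_iff.2 h])
        exact ⟨_, Or.inr (Or.inl ⟨hj, rfl⟩)⟩
      | cast j => exact ⟨_, Or.inl ⟨⟨j, η, hj⟩, rfl⟩⟩)
  -- The new homotopy is the face s = 0, the one omitted from the box.
  refine ⟨X.act w (snoc (face (Fin.last n) false)), fun m a ha => ?_, fun ε => ?_⟩
  · have h1 : S (a ≫ snoc (face (Fin.last n) false)) := by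
      obtain ⟨i, ε, h⟩ := ha
      refine ⟨i, ε, fun v => (snoc_castSucc _ _ _).trans ?_⟩
      exact (face_last_castSucc _ _ _).trans (h v)
    have h2 : OnOpenBox (Fin.last n).castSucc false (a ≫ snoc (face (Fin.last n) false)) := by
      obtain ⟨i, ε, h⟩ := id h1
      exact ⟨i.castSucc.castSucc, ε, by simp [Prod.ext_iff, Fin.ext_iff]; omega, h⟩
    rw [act_act, hw _ _ h2 _ (Or.inl ⟨h1, rfl⟩), Category.assoc, ← snoc_comp, face_false_pinch]
  · have h1 : OnFace (face (Fin.last n) false ≫ face (Fin.last (n + 1)) ε) (Fin.last (n + 1)) ε :=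
      (onFace_face _ _).precomp _
    rw [act_act, face_last_snoc, hw _ _ ⟨Fin.last (n + 1), ε, by simp [Prod.ext_iff, Fin.ext_iff],
      h1⟩ _ (Or.inr (Or.inr ⟨ε, h1, rfl⟩)), Category.assoc, face_deg, Category.comp_id, (hT ε).2.1]

/-- The contractions at the two ends are arbitrary; this is why the class obtained in π_n does not
depend on the chosen fillers. -/
theorem IsKan.exists_sideAgrees (hX : IsKan X) {W : X.cells (n + 2)} :
    ∀ (k : ℕ) {H : X.cells (n + 1)}, SideAgrees k W H → ∀ {u : Bool → X.cells n},
      (∀ ε, Contraction (X.act W (face (Fin.last (n + 1)) ε)) k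
        (X.act H (face (Fin.last n) ε)) (u ε)) →
      ∃ H', SideAgrees 0 W H' ∧ ∀ ε, X.act H' (face (Fin.last n) ε) = u ε
  | 0, H, hH, u, hu => ⟨H, hH, hu⟩
  | k + 1, H, hH, u, hu => by
    choose h' T hT hu using hu
    obtain ⟨H', hH', h⟩ := hX.exists_sideAgrees_step hH hT
    exact hX.exists_sideAgrees k hH' fun ε => by rw [h]; exact hu ε

end CSet

namespace PtCSet

open CSet Box

/-! #### Cubes and paths of iterated loop spaces -/

theorem loopCube_injective : ∀ (n : ℕ) (X : PtCSet.{u}), Function.Injective (loopCube n X)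
  | 0, _ => fun _ _ h => h
  | n + 1, X => fun _ _ h => loopCube_injective n (loop.obj X) (Subtype.ext h)

/-- The faces in the first direction make `w` a cube of the loop space; `Box.cons` shifts the
remaining faces by one index. -/
theorem exists_loopCube : ∀ (n : ℕ) (X : PtCSet.{u}) (w : X.toCSet.cells n),
    (∀ (m : ℕ) (a : (⟨m⟩ : Box) ⟶ ⟨n⟩), OnBoundary a → X.toCSet.act w a = X.toCSet.const X.pt m) →
    ∃ c, loopCube n X c = w
  | 0, _, w, _ => ⟨w, rfl⟩
  | n + 1, X, w, hw => by
    obtain ⟨c, hc⟩ := exists_loopCube n (loop.obj X)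
      ⟨w, fun ε => hw _ _ ⟨0, ε, onFace_face 0 ε⟩⟩ fun m a ha => by
        refine Subtype.ext ((hw _ (Box.cons a) ?_).trans (loop_const_val X m).symm)
        obtain ⟨i, ε, h⟩ := ha
        exact ⟨i.succ, ε, fun v => h _⟩
    exact ⟨c, congrArg Subtype.val hc⟩

theorem loopCube_naturality : ∀ (n : ℕ) {X Y : PtCSet.{u}} (f : X ⟶ Y)
    (a : ((iterLoop n).obj X).toCSet.cells 0),
    loopCube n Y (((iterLoop n).map f).map.app _ a) = f.map.app _ (loopCube n X a)
  | 0, _, _, _, _ => rfl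
  | n + 1, _, _, f, a => congrArg Subtype.val (loopCube_naturality n (loop.map f) a)

/-- The `(n+1)`-cube of `X` corresponding to a `1`-cube of `Ω^n(X, x)`. -/
def loopPath : ∀ (n : ℕ) (X : PtCSet.{u}),
    ((iterLoop n).obj X).toCSet.cells 1 → X.toCSet.cells (n + 1)
  | 0, _ => fun c => c
  | n + 1, X => fun c => (loopPath n (loop.obj X) c).1

/-- Each loop coordinate is added in front, so the path coordinate stays the last one. -/
theorem loopPath_face : ∀ (n : ℕ) (X : PtCSet.{u}) (c : ((iterLoop n).obj X).toCSet.cells 1)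
    (ε : Bool), X.toCSet.act (loopPath n X c) (face (Fin.last n) ε) =
      loopCube n X (((iterLoop n).obj X).toCSet.act c (face 0 ε))
  | 0, _, _, _ => rfl
  | n + 1, X, c, ε => by
    rw [← Fin.succ_last, Box.face_succ]
    exact congrArg Subtype.val (loopPath_face n (loop.obj X) c ε)

theorem loopPath_side : ∀ (n : ℕ) (X : PtCSet.{u}) (c : ((iterLoop n).obj X).toCSet.cells 1)
    {m : ℕ} {a : (⟨m⟩ : Box) ⟶ ⟨n + 1⟩}, OnSide a →
      X.toCSet.act (loopPath n X c) a = X.toCSet.const X.pt m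
  | 0, _, _, _, _, ⟨i, _⟩ => i.elim0
  | n + 1, X, c, m, a, ⟨i, ε, h⟩ => by
    rw [← act_of_onFace _ h]
    suffices hs : X.toCSet.act (loopPath (n + 1) X c) (face i.castSucc ε) =
        X.toCSet.const X.pt (n + 1) by rw [hs, const_act]
    induction i using Fin.cases with
    | zero => exact (loopPath n (loop.obj X) c).2 ε
    | succ j =>
      rw [← Fin.succ_castSucc, Box.face_succ, ← loop_const_val]
      exact congrArg Subtype.val
        (loopPath_side n (loop.obj X) c ⟨j, ε, onFace_face j.castSucc ε⟩)

theorem exists_loopPath : ∀ (n : ℕ) (X : PtCSet.{u}) (w : X.toCSet.cells (n + 1)),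
    (∀ (m : ℕ) (a : (⟨m⟩ : Box) ⟶ ⟨n + 1⟩), OnSide a → X.toCSet.act w a = X.toCSet.const X.pt m) →
    ∃ c, loopPath n X c = w
  | 0, _, w, _ => ⟨w, rfl⟩
  | n + 1, X, w, hw => by
    obtain ⟨c, hc⟩ := exists_loopPath n (loop.obj X)
      ⟨w, fun ε => hw _ _ ⟨0, ε, onFace_face 0 ε⟩⟩ fun m a ha => by
        refine Subtype.ext ((hw _ (Box.cons a) ?_).trans (loop_const_val X m).symm)
        obtain ⟨i, ε, h⟩ := ha
        exact ⟨i.succ, ε, fun v => h _⟩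
    exact ⟨c, congrArg Subtype.val hc⟩

theorem homotopyGroupMk_eq {n : ℕ} {X : PtCSet.{u}} {a b : ((iterLoop n).obj X).toCSet.cells 0}
    (w : X.toCSet.cells (n + 1))
    (hw : ∀ (m : ℕ) (e : (⟨m⟩ : Box) ⟶ ⟨n + 1⟩), OnSide e →
      X.toCSet.act w e = X.toCSet.const X.pt m)
    (h0 : X.toCSet.act w (face (Fin.last n) false) = loopCube n X a)
    (h1 : X.toCSet.act w (face (Fin.last n) true) = loopCube n X b) :
    homotopyGroupMk n X a = homotopyGroupMk n X b := by
  obtain ⟨c, rfl⟩ := exists_loopPath n X w hw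
  rw [loopPath_face] at h0 h1
  rw [← loopCube_injective n X h0, ← loopCube_injective n X h1]
  exact pi0Mk_eq_of_path _ c

/-- The boundary of the cube corresponding to a `0`-cube of `Ω^n(X, x)` is degenerate at `x`. -/
theorem loopCube_boundary {n : ℕ} {X : PtCSet.{u}} (c : ((iterLoop n).obj X).toCSet.cells 0)
    {m : ℕ} {a : (⟨m⟩ : Box) ⟶ ⟨n⟩} (ha : OnBoundary a) :
    X.toCSet.act (loopCube n X c) a = X.toCSet.const X.pt m := by
  obtain ⟨i, ε, h⟩ := ha
  cases n with
  | zero => exact i.elim0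
  | succ n => rw [← act_of_onFace _ h, loopCube_face, const_act]

/-! #### Maps out of the boundary, glued from an open box and a face -/

section Glue

variable {n : ℕ} {X : PtCSet.{u}}

/-- The map `f : ∂□^(n+1) → X` is given by `F` on the open box omitting the face `∂_{n+1,1}`, and
by `h` on that face. -/
structure IsGlued (f : ptBoundary n ⟶ X) (F : X.toCSet.cells (n + 1)) (h : X.toCSet.cells n) :
    Prop where
  openBox : ∀ (m : ℕ) (a : (⟨m⟩ : Box) ⟶ ⟨n + 1⟩) (ha : OnOpenBox (Fin.last n) true a),
    bdVal f.map a ha.onBoundary = X.toCSet.act F a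
  face : ∀ (m : ℕ) (a : (⟨m⟩ : Box) ⟶ ⟨n + 1⟩) (ha : OnFace a (Fin.last n) true),
    bdVal f.map a ⟨_, _, ha⟩ = X.toCSet.act h (a ≫ deg (Fin.last n))

theorem IsGlued.unique {f g : ptBoundary n ⟶ X} {F : X.toCSet.cells (n + 1)}
    {h : X.toCSet.cells n} (hf : IsGlued f F h) (hg : IsGlued g F h) : f = g := by
  refine PtCSet.hom_ext (bdVal_ext fun m a ha => ?_)
  rcases ha.cases (Fin.last n) true with h1 | h1
  · rw [hf.face _ _ h1, hg.face _ _ h1]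
  · rw [hf.openBox _ _ h1, hg.openBox _ _ h1]

theorem zeroVertex_onOpenBox (n : ℕ) : OnOpenBox (Fin.last n) true (zeroVertex (n + 1)) :=
  ⟨Fin.last n, false, by simp, fun v => zeroVertex_apply _ v _⟩

theorem bdVal_zeroVertex (f : ptBoundary n ⟶ X) (h : OnBoundary (zeroVertex (n + 1))) :
    bdVal f.map (zeroVertex (n + 1)) h = X.pt := f.map_pt

theorem IsGlued.zeroVertex {f : ptBoundary n ⟶ X} {F : X.toCSet.cells (n + 1)}
    {h : X.toCSet.cells n} (hf : IsGlued f F h) :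
    X.toCSet.act F (zeroVertex (n + 1)) = X.pt := by
  rw [← hf.openBox _ _ (zeroVertex_onOpenBox n), bdVal_zeroVertex]

/-- Starting point of the contraction: on [1]^(n+1), `truncate (n + 1)` is the identity. -/
theorem IsGlued.boundaryAgrees {f : ptBoundary n ⟶ X} {F : X.toCSet.cells (n + 1)}
    {h : X.toCSet.cells n} (hf : IsGlued f F h) : BoundaryAgrees (n + 1) F h := by
  intro m a ha
  have h1 : OnFace (a ≫ Box.face (Fin.last n) true) (Fin.last n) true :=
    (onFace_face _ _).precomp a
  have h2 := hf.face _ _ h1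
  rw [Category.assoc, face_deg, Category.comp_id] at h2
  rw [← h2, hf.openBox _ _ ((ha.face_last true).onOpenBox true), topTruncate,
    truncate_of_lt (Nat.lt_succ_self n), Category.comp_id]

theorem act_eq_const {N m : ℕ} {F : X.toCSet.cells N}
    (hF : X.toCSet.act F (zeroVertex N) = X.pt) {a : (⟨m⟩ : Box) ⟶ ⟨N⟩}
    (ha : ∀ i, OnFace a i false) : X.toCSet.act F a = X.toCSet.const X.pt m := by
  have : a = toZero m ≫ zeroVertex N := by
    refine Box.hom_ext fun v j => ?_
    rw [ha j v, comp_toFun, zeroVertex_apply]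
  rw [this, ← act_act, hF]
  rfl

theorem exists_isGlued {F : X.toCSet.cells (n + 1)} {h : X.toCSet.cells n}
    (hF : X.toCSet.act F (zeroVertex (n + 1)) = X.pt)
    (hh : ∀ (m : ℕ) (a : (⟨m⟩ : Box) ⟶ ⟨n⟩), OnBoundary a →
      X.toCSet.act h a = X.toCSet.act F (a ≫ face (Fin.last n) true)) :
    ∃ f : ptBoundary n ⟶ X, IsGlued f F h := by
  have key {m : ℕ} {a : (⟨m⟩ : Box) ⟶ ⟨n + 1⟩} (h1 : OnOpenBox (Fin.last n) true a)
      (h2 : OnFace a (Fin.last n) true) :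
      X.toCSet.act F a = X.toCSet.act h (a ≫ deg (Fin.last n)) := by
    -- The two pieces overlap only in the boundary of the omitted face, where `hh` applies.
    rw [hh _ _ (h1.onSide h2).deg_last, h2.deg_face]
  let R : PartialCube X.toCSet (n + 1) :=
    { rel := fun {m} a x => (OnOpenBox (Fin.last n) true a ∧ x = X.toCSet.act F a) ∨
        (OnFace a (Fin.last n) true ∧ x = X.toCSet.act h (a ≫ deg (Fin.last n)))
      functional := by
        rintro m a x y (⟨h1, rfl⟩ | ⟨h1, rfl⟩) (⟨h2, rfl⟩ | ⟨h2, rfl⟩)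
        · rfl
        · exact key h1 h2
        · exact (key h2 h1).symm
        · rfl
      stable := by
        rintro l m a x (⟨h1, rfl⟩ | ⟨h1, rfl⟩) b
        · exact Or.inl ⟨h1.precomp b, by rw [act_act]⟩
        · exact Or.inr ⟨h1.precomp b, by rw [act_act, Category.assoc]⟩ }
  obtain ⟨φ, hφ⟩ := R.exists_map (boundary (n + 1)) fun m a ha => by
    rcases OnBoundary.cases ((mem_boundary _ _ _).1 ha) (Fin.last n) true with h1 | h1
    · exact ⟨_, Or.inr ⟨h1, rfl⟩⟩
    · exact ⟨_, Or.inl ⟨h1, rfl⟩⟩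
  refine ⟨⟨φ, ?_⟩, fun m a ha => ?_, fun m a ha => ?_⟩
  · refine Eq.trans ?_ hF
    exact R.functional (hφ _ _ _) (Or.inl ⟨zeroVertex_onOpenBox n, rfl⟩)
  · exact R.functional (hφ _ _ _) (Or.inl ⟨ha, rfl⟩)
  · exact R.functional (hφ _ _ _) (Or.inr ⟨ha, rfl⟩)

/-- The partial cube given by a map out of the boundary. -/
def bdPartial {X : CSet.{u}} {n : ℕ} (f : (boundary.{u} n).toFunctor ⟶ X) : PartialCube X n where
  rel {_} a x := ∃ ha, x = bdVal f a ha
  functional := by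
    rintro m a x y ⟨_, rfl⟩ ⟨_, rfl⟩
    rfl
  stable := by
    rintro l m a x ⟨ha, rfl⟩ b
    exact ⟨ha.precomp b, bdVal_act f a ha b⟩

/-- Every map from the boundary to a Kan complex is glued from two cubes. -/
theorem exists_isGlued_of_map (hX : IsKan X.toCSet) (f : ptBoundary n ⟶ X) :
    ∃ F h, IsGlued f F h := by
  obtain ⟨F, hF⟩ := hX.fill (Fin.last n) true (bdPartial f.map) fun m a ha =>
    ⟨_, ha.onBoundary, rfl⟩
  refine ⟨F, bdVal f.map (face (Fin.last n) true) ⟨_, _, onFace_face _ _⟩, fun m a ha => ?_,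
    fun m a ha => ?_⟩
  · exact (hF _ _ ha _ ⟨ha.onBoundary, rfl⟩).symm
  · exact (bdVal_congr _ ha.deg_face.symm _ _).trans (bdVal_act _ _ _ _).symm

/-- The collapse sends the open box to the point [0], so the constant cube serves as `F`. -/
theorem isGlued_boundaryMapOfLoop (c : ((iterLoop n).obj X).toCSet.cells 0) :
    IsGlued (boundaryMapOfLoop n X c) (X.toCSet.const X.pt (n + 1)) (loopCube n X c) where
  openBox m a ha := by
    rw [const_act]
    refine (congrArg ((quotMapOfLoop n X c).map.app (op ⟨m⟩))
      (collapseApp_of_mem n (op ⟨m⟩) (ULift.up a) ((mem_openBox _ _ a).2 ha))).trans ?_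
    exact ConcreteCategory.congr_hom (NatTrans.congr_app (Limits.pushout.inl_desc
      (f := toPoint (boundary.{u} n).toFunctor) (g := (boundary.{u} n).ι) X.ptMap
      (cubeMap (loopCube n X c)) (quotMapOfLoop_aux n X c)) (op ⟨m⟩)) _
  face m a ha := by
    refine (congrArg ((quotMapOfLoop n X c).map.app (op ⟨m⟩))
      (collapseApp_of_mem_face n (op ⟨m⟩) (ULift.up a) ((mem_faceImage _ _ _ _).2 ha))).trans ?_
    exact ConcreteCategory.congr_hom (NatTrans.congr_app (Limits.pushout.inr_desc
      (f := toPoint (boundary.{u} n).toFunctor) (g := (boundary.{u} n).ι) X.ptMap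
      (cubeMap (loopCube n X c)) (quotMapOfLoop_aux n X c)) (op ⟨m⟩)) _

/-- A homotopy between maps out of the boundary, glued from a homotopy `V` on the open box and a
homotopy `T` on the remaining face. -/
theorem homotopic_of_isGlued {f : Bool → (ptBoundary n ⟶ X)} {V : X.toCSet.cells (n + 2)}
    {T : X.toCSet.cells (n + 1)}
    (hVT : ∀ (m : ℕ) (a : (⟨m⟩ : Box) ⟶ ⟨n + 1⟩), OnSide a →
      X.toCSet.act T a = X.toCSet.act V (a ≫ snoc (face (Fin.last n) true)))
    (hV : ∀ (m : ℕ) (a : (⟨m⟩ : Box) ⟶ ⟨n + 2⟩), (∀ i : Fin (n + 1), OnFace a i.castSucc false) →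
      X.toCSet.act V a = X.toCSet.const X.pt m)
    (hf : ∀ ε, IsGlued (f ε) (X.toCSet.act V (face (Fin.last (n + 1)) ε))
      (X.toCSet.act T (face (Fin.last n) ε))) :
    Homotopic (f false) (f true) := by
  let S : ∀ {m : ℕ}, ((⟨m⟩ : Box) ⟶ ⟨n + 2⟩) → Prop := fun a =>
    ∃ i : Fin (n + 1), ∃ ε, (i, ε) ≠ (Fin.last n, true) ∧ OnFace a i.castSucc ε
  have key {m : ℕ} {a : (⟨m⟩ : Box) ⟶ ⟨n + 2⟩} (h1 : S a)
      (h2 : OnFace a (Fin.last n).castSucc true) :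
      X.toCSet.act V a = X.toCSet.act T (a ≫ snoc (deg (Fin.last n))) := by
    rw [hVT, h2.snoc_face]
    obtain ⟨i, ε, hne, h⟩ := h1
    induction i using Fin.lastCases with
    | last => exact absurd (by rw [h.unique h2]) hne
    | cast i =>
      refine ⟨i, ε, fun v => (snoc_castSucc _ _ _).trans ?_⟩
      exact (deg_last_apply _ _).trans (h v)
  -- `V` gives the homotopy on the open box and `T` on the face x_n = 1; they meet only over the
  -- boundary of that face, where `hVT` applies.
  let R : PartialCube X.toCSet (n + 2) :=
    { rel := fun {m} a x => (S a ∧ x = X.toCSet.act V a) ∨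
        (OnFace a (Fin.last n).castSucc true ∧ x = X.toCSet.act T (a ≫ snoc (deg (Fin.last n))))
      functional := by
        rintro m a x y (⟨h1, rfl⟩ | ⟨h1, rfl⟩) (⟨h2, rfl⟩ | ⟨h2, rfl⟩)
        · rfl
        · exact key h1 h2
        · exact (key h2 h1).symm
        · rfl
      stable := by
        rintro l m a x (⟨⟨i, ε, hne, h1⟩, rfl⟩ | ⟨h1, rfl⟩) b
        · exact Or.inl ⟨⟨i, ε, hne, h1.precomp b⟩, by rw [act_act]⟩
        · exact Or.inr ⟨h1.precomp b, by rw [act_act, Category.assoc]⟩ }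
  have hend (ε : Bool) (m : ℕ) (a : (⟨m⟩ : Box) ⟶ ⟨n + 1⟩) (ha : OnBoundary a) :
      R.rel (a ≫ face (Fin.last (n + 1)) ε) (bdVal (f ε).map a ha) := by
    rcases ha.cases (Fin.last n) true with h1 | h1
    · refine Or.inr ⟨fun v => (face_last_castSucc _ _ _).trans (h1 v), ?_⟩
      rw [(hf ε).face _ _ h1, act_act, Category.assoc, Category.assoc, face_last_snoc]
    · rw [(hf ε).openBox _ _ h1, act_act]
      obtain ⟨i, η, hne, h1⟩ := h1
      exact Or.inl ⟨⟨i, η, hne, fun v => (face_last_castSucc _ _ _).trans (h1 v)⟩, rfl⟩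
  refine (homotopic_iff _ _).2 ⟨R, ?_, hend false, hend true, fun m a ha => ?_⟩
  · rintro m a ⟨i, ε, h⟩
    by_cases hi : (i, ε) = (Fin.last n, true)
    · obtain ⟨rfl, rfl⟩ := Prod.ext_iff.1 hi
      exact ⟨_, Or.inr ⟨h, rfl⟩⟩
    · exact ⟨_, Or.inl ⟨⟨i, ε, hi, h⟩, rfl⟩⟩
  · exact Or.inl ⟨⟨0, false, by simp, ha 0⟩, (hV m a ha).symm⟩

/-- Degenerating both pieces of a gluing in the last direction gives the constant homotopy. -/
theorem Homotopic.refl_of_isKan (hX : IsKan X.toCSet) (f : ptBoundary n ⟶ X) : Homotopic f f := by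
  obtain ⟨F, h, hf⟩ := exists_isGlued_of_map hX f
  have hb := hf.boundaryAgrees
  refine homotopic_of_isGlued (f := fun _ => f) (V := X.toCSet.act F (deg (Fin.last (n + 1))))
    (T := X.toCSet.act h (deg (Fin.last n))) (fun m a ha => ?_) (fun m a ha => ?_) fun ε => ?_
  · rw [act_act, act_act, hb _ _ ha.deg_last, topTruncate, truncate_of_lt (Nat.lt_succ_self n),
      Category.comp_id, Category.assoc, Category.assoc, snoc_deg_last]
  · rw [act_act]
    exact act_eq_const hf.zeroVertex fun i v => (deg_last_apply _ _).trans (ha i v)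
  · rw [act_act, act_act, face_deg, face_deg, act_id, act_id]
    exact hf

theorem homotopic_boundaryMapOfLoop (c : ((iterLoop n).obj X).toCSet.cells 1) :
    Homotopic (boundaryMapOfLoop n X (((iterLoop n).obj X).toCSet.act c (face 0 false)))
      (boundaryMapOfLoop n X (((iterLoop n).obj X).toCSet.act c (face 0 true))) := by
  refine homotopic_of_isGlued
    (f := fun ε => boundaryMapOfLoop n X (((iterLoop n).obj X).toCSet.act c (face 0 ε)))
    (V := X.toCSet.const X.pt (n + 2)) (T := loopPath n X c) (fun m a ha => ?_)
    (fun m a ha => const_act _ _ _) fun ε => ?_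
  · rw [const_act, loopPath_side n X c ha]
  · rw [const_act, loopPath_face]
    exact isGlued_boundaryMapOfLoop _

/-! #### The inverse bijection, as a relation -/

/-- `c` is obtained from `f` by contracting the open box omitting the face `∂_{n+1,1}`. -/
def Represents (f : ptBoundary n ⟶ X) (c : ((iterLoop n).obj X).toCSet.cells 0) : Prop :=
  ∃ F h, IsGlued f F h ∧ Contraction F (n + 1) h (loopCube n X c)

theorem act_topTruncate_zero {F : X.toCSet.cells (n + 1)}
    (hF : X.toCSet.act F (zeroVertex (n + 1)) = X.pt) {m : ℕ} (a : (⟨m⟩ : Box) ⟶ ⟨n⟩) :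
    X.toCSet.act F (a ≫ topTruncate 0) = X.toCSet.const X.pt m :=
  act_eq_const hF fun _ _ => truncate_zero_apply _ _

theorem exists_represents (hX : IsKan X.toCSet) (f : ptBoundary n ⟶ X) :
    ∃ c, Represents f c := by
  obtain ⟨F, h, hf⟩ := exists_isGlued_of_map hX f
  obtain ⟨w, hw, hw'⟩ := hX.exists_contraction (n + 1) hf.boundaryAgrees
  obtain ⟨c, rfl⟩ := exists_loopCube n X w fun m a ha =>
    (hw' m a ha).trans (act_topTruncate_zero hf.zeroVertex a)
  exact ⟨c, F, h, hf, hw⟩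

/-- With `F` constant, each step can be taken to be the degenerate cube on `loopCube n X c`. -/
theorem represents_boundaryMapOfLoop (c : ((iterLoop n).obj X).toCSet.cells 0) :
    Represents (boundaryMapOfLoop n X c) c := by
  refine ⟨_, _, isGlued_boundaryMapOfLoop c, ?_⟩
  have key (k : ℕ) : Contraction (X.toCSet.const X.pt (n + 1)) k (loopCube n X c)
      (loopCube n X c) := by
    induction k with
    | zero => rfl
    | succ k ih =>
      refine ⟨_, X.toCSet.act (loopCube n X c) (deg (Fin.last n)), ⟨?_, ?_, fun m a ha => ?_⟩, ih⟩
      · rw [act_act, face_deg, act_id]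
      · rw [act_act, face_deg, act_id]
      · rw [act_act, const_act, loopCube_boundary c ha.deg_last]
  exact key _

/-- Every stage of the contraction is itself a map out of the boundary, glued from `F` truncated and
the current n-cube, and each step is a pointed homotopy between consecutive stages. -/
theorem exists_classOf_eq_of_contraction {F : X.toCSet.cells (n + 1)}
    (hF : X.toCSet.act F (zeroVertex (n + 1)) = X.pt) {w : X.toCSet.cells n} :
    ∀ (k : ℕ) {f : ptBoundary n ⟶ X} {h : X.toCSet.cells n},
      IsGlued f (X.toCSet.act F (truncate k)) h → Contraction F k h w →
      ∃ g : ptBoundary n ⟶ X, IsGlued g (X.toCSet.act F (truncate 0)) w ∧ classOf f = classOf g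
  | 0, f, h, hf, hw => ⟨f, hw ▸ hf, rfl⟩
  | k + 1, f, h, hf, ⟨h', T, hT, hw⟩ => by
    obtain ⟨g, hg⟩ : ∃ g : ptBoundary n ⟶ X, IsGlued g (X.toCSet.act F (truncate k)) h' := by
      refine exists_isGlued ?_ fun m a ha => ?_
      · rw [act_act]
        refine (act_eq_const hF fun i v => ?_).trans (const_zero _ _)
        rw [comp_toFun, truncate_apply, zeroVertex_apply, ite_self]
      · rw [hT.boundaryAgrees _ _ ha, act_act, Category.assoc, topTruncate]
    have hgf : Homotopic g f := by
      -- `contract k` supplies the homotopy on the open box and `T` the one on the remaining face.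
      -- The base point stays fixed because `contract k` sends x = 0 to 0 for every t.
      refine homotopic_of_isGlued (f := fun ε => bif ε then f else g)
        (V := X.toCSet.act F (contract k)) (T := T) (fun m a ha => ?_) (fun m a ha => ?_) ?_
      · rw [hT.2.2 _ _ ha, act_act, Category.assoc, pinch]
      · rw [act_act]
        refine act_eq_const hF fun i v => ?_
        change contractFun k (a.toFun v) i = false
        rw [contractFun, ha i v]
        simp
      · rintro (_ | _)
        · rw [act_act, hT.2.1]
          exact hg
        · rw [act_act, hT.1, face_true_contract]
          exact hf
    obtain ⟨g', hg', h⟩ := exists_classOf_eq_of_contraction hF k hg hw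
    exact ⟨g', hg', (Quot.sound hgf).symm.trans h⟩

theorem Represents.classOf_eq {f : ptBoundary n ⟶ X} {c : ((iterLoop n).obj X).toCSet.cells 0}
    (h : Represents f c) : classOf f = classOf (boundaryMapOfLoop n X c) := by
  obtain ⟨F, h, hf, hw⟩ := h
  obtain ⟨g, hg, hfg⟩ := exists_classOf_eq_of_contraction hf.zeroVertex (n + 1) (f := f) (h := h)
    (by rw [truncate_of_lt (Nat.lt_succ_self n), act_id]; exact hf) hw
  rw [act_eq_const hf.zeroVertex fun i v => truncate_zero_apply v i] at hg
  rw [hfg, hg.unique (isGlued_boundaryMapOfLoop c)]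

/-- The homotopy on the open box is first extended to an (n+2)-cube `W` joining the given `F false`
and `F true`. The homotopy `H` on the face x_n = 1 is then contracted along `W`, and its final stage
is a path in Ω^n. -/
theorem homotopyGroupMk_eq_of_homotopic (hX : IsKan X.toCSet) {f : Bool → (ptBoundary n ⟶ X)}
    (hf : Homotopic (f false) (f true)) {c : Bool → ((iterLoop n).obj X).toCSet.cells 0}
    (hc : ∀ ε, Represents (f ε) (c ε)) :
    homotopyGroupMk n X (c false) = homotopyGroupMk n X (c true) := by
  choose F h hF hFc using hc
  obtain ⟨R, ht, h0, h1, hpt⟩ := (homotopic_iff _ _).1 hf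
  have hend (ε : Bool) (m : ℕ) (a : (⟨m⟩ : Box) ⟶ ⟨n + 1⟩) (ha : OnBoundary a) :
      R.rel (a ≫ face (Fin.last (n + 1)) ε) (bdVal (f ε).map a ha) := by
    cases ε
    · exact h0 m a ha
    · exact h1 m a ha
  let S : ∀ {m : ℕ}, ((⟨m⟩ : Box) ⟶ ⟨n + 2⟩) → Prop := fun a =>
    ∃ i : Fin (n + 1), ∃ ε, (i, ε) ≠ (Fin.last n, true) ∧ OnFace a i.castSucc ε
  have hS {m : ℕ} {a : (⟨m⟩ : Box) ⟶ ⟨n + 2⟩} (ha : S a) :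
      OnOpenBox (Fin.last n).castSucc true a := by
    obtain ⟨i, ε, hne, h⟩ := ha
    refine ⟨i.castSucc, ε, fun h => hne ?_, h⟩
    rw [Prod.ext_iff] at h ⊢
    exact ⟨Fin.castSucc_injective _ h.1, h.2⟩
  have key {m : ℕ} {a : (⟨m⟩ : Box) ⟶ ⟨n + 2⟩} {ε : Bool} (h1 : S a)
      (h2 : OnFace a (Fin.last (n + 1)) ε) :
      R.rel a (X.toCSet.act (F ε) (a ≫ deg (Fin.last (n + 1)))) := by
    obtain ⟨i, η, hne, h⟩ := h1
    have h3 : OnOpenBox (Fin.last n) true (a ≫ deg (Fin.last (n + 1))) :=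
      ⟨i, η, hne, fun v => (deg_last_apply _ _).trans (h v)⟩
    have h4 := hend ε m _ h3.onBoundary
    rwa [h2.deg_face, (hF ε).openBox _ _ h3] at h4
  let R' : PartialCube X.toCSet (n + 2) :=
    { rel := fun {m} a x => (S a ∧ R.rel a x) ∨ ∃ ε, OnFace a (Fin.last (n + 1)) ε ∧
        x = X.toCSet.act (F ε) (a ≫ deg (Fin.last (n + 1)))
      functional := by
        rintro m a x y (⟨h1, hx⟩ | ⟨ε, h1, rfl⟩) (⟨h2, hy⟩ | ⟨η, h2, rfl⟩)
        · exact R.functional hx hy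
        · exact R.functional hx (key h1 h2)
        · exact R.functional (key h2 h1) hy
        · rw [h1.unique h2]
      stable := by
        rintro l m a x (⟨⟨i, ε, hne, h1⟩, hx⟩ | ⟨ε, h1, rfl⟩) b
        · exact Or.inl ⟨⟨i, ε, hne, h1.precomp b⟩, R.stable hx b⟩
        · exact Or.inr ⟨ε, h1.precomp b, by rw [act_act, Category.assoc]⟩ }
  -- The omitted face is x_n = 1, where the homotopy is kept separately as `H`.
  obtain ⟨W, hW⟩ := hX.fill (Fin.last n).castSucc true R' (by
    rintro m a ⟨j, η, hne, hj⟩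
    induction j using Fin.lastCases with
    | last => exact ⟨_, Or.inr ⟨η, hj, rfl⟩⟩
    | cast j =>
      obtain ⟨x, hx⟩ := ht m a ⟨j, η, hj⟩
      refine ⟨x, Or.inl ⟨⟨j, η, fun h => hne ?_, hj⟩, hx⟩⟩
      rw [Prod.ext_iff] at h ⊢
      exact ⟨congrArg Fin.castSucc h.1, h.2⟩)
  have hWF (ε : Bool) : X.toCSet.act W (face (Fin.last (n + 1)) ε) = F ε := by
    rw [hW _ _ ⟨Fin.last (n + 1), ε, by simp [Prod.ext_iff, Fin.ext_iff], onFace_face _ _⟩ _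
      (Or.inr ⟨ε, onFace_face _ _, rfl⟩), face_deg, act_id]
  obtain ⟨H, hH⟩ := ht _ (snoc (face (Fin.last n) true))
    ⟨Fin.last n, true, fun v => (snoc_castSucc _ _ _).trans (face_last_last _ _)⟩
  have hHh (ε : Bool) : X.toCSet.act H (face (Fin.last n) ε) = h ε := by
    have h1 := R.stable hH (face (Fin.last n) ε)
    rw [face_last_snoc] at h1
    rw [R.functional h1 (hend ε _ (face (Fin.last n) true) ⟨_, _, onFace_face _ _⟩),
      (hF ε).face _ _ (onFace_face _ _), face_deg, act_id]
  have hside : SideAgrees (n + 1) W H := by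
    intro m a ha
    have h1 : S (a ≫ snoc (face (Fin.last n) true)) := by
      obtain ⟨i, ε, h⟩ := ha
      refine ⟨i.castSucc, ε, fun h => (Fin.castSucc_lt_last i).ne (congrArg Prod.fst h),
        fun v => (snoc_castSucc _ _ _).trans ?_⟩
      exact (face_last_castSucc _ _ _).trans (h v)
    rw [topTruncate, truncate_of_lt (Nat.lt_succ_self n), Category.comp_id]
    exact (hW _ _ (hS h1) _ (Or.inl ⟨h1, R.stable hH a⟩)).symm
  obtain ⟨H', hH', hHc⟩ := hX.exists_sideAgrees (n + 1) hside (u := fun ε => loopCube n X (c ε))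
    fun ε => by rw [hWF, hHh]; exact hFc ε
  refine homotopyGroupMk_eq H' (fun m a ha => ?_) (hHc false) (hHc true)
  -- After the contraction the side of `H'` runs inside 0 ⊗ □^1, where the pointed homotopy is
  -- constant.
  have h1 : ∀ i : Fin (n + 1), OnFace (a ≫ snoc (topTruncate 0)) i.castSucc false :=
    fun i v => (snoc_castSucc _ _ _).trans (truncate_zero_apply _ _)
  have h2 : S (a ≫ snoc (topTruncate 0)) := ⟨0, false, by simp, h1 0⟩
  rw [hH' _ _ ha]
  exact hW _ _ (hS h2) _ (Or.inl ⟨h2, hpt _ _ h1⟩)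

/-- The reflexive case is not trivial: it compares two representatives of one map, by means of its
constant homotopy. -/
theorem homotopyGroupMk_eq_of_eqvGen (hX : IsKan X.toCSet) {f g : ptBoundary n ⟶ X}
    (h : Relation.EqvGen Homotopic f g) {c d : ((iterLoop n).obj X).toCSet.cells 0}
    (hc : Represents f c) (hd : Represents g d) :
    homotopyGroupMk n X c = homotopyGroupMk n X d := by
  have key {f g : ptBoundary n ⟶ X} (h : Homotopic f g)
      {c d : ((iterLoop n).obj X).toCSet.cells 0} (hc : Represents f c) (hd : Represents g d) :
      homotopyGroupMk n X c = homotopyGroupMk n X d :=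
    homotopyGroupMk_eq_of_homotopic hX (f := fun ε => bif ε then g else f) h
      (c := fun ε => bif ε then d else c) (by rintro (_ | _); exacts [hc, hd])
  induction h generalizing c d with
  | rel f g h => exact key h hc hd
  | refl f => exact key (Homotopic.refl_of_isKan hX f) hc hd
  | symm f g _ ih => exact (ih hd hc).symm
  | trans f g k _ _ ih1 ih2 =>
    obtain ⟨e, he⟩ := exists_represents hX g
    exact (ih1 hc he).trans (ih2 he hd)

/-! #### Fillers -/

theorem hasFiller_iff (f : ptBoundary n ⟶ X) :
    HasFiller f ↔ ∃ w : X.toCSet.cells (n + 1), ∀ (m : ℕ) (a : (⟨m⟩ : Box) ⟶ ⟨n + 1⟩)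
      (ha : OnBoundary a), X.toCSet.act w a = bdVal f.map a ha := by
  constructor
  · rintro ⟨G, hG⟩
    refine ⟨G.app _ (ULift.up (𝟙 _)), fun m a ha => ?_⟩
    rw [← hG, ← naturality_act]
    exact congrArg (G.app _) (congrArg ULift.up (Category.comp_id a))
  · rintro ⟨w, hw⟩
    exact ⟨cubeMap w, bdVal_ext fun m a ha => hw m a ha⟩

/-- The homotopy together with a filler at one end is an open box in □^(n+2); the face missing from
it is a filler at the other end. -/
theorem HasFiller.of_homotopic (hX : IsKan X.toCSet) {f : Bool → (ptBoundary n ⟶ X)}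
    (hf : Homotopic (f false) (f true)) {ε : Bool} (h : HasFiller (f ε)) :
    HasFiller (f !ε) := by
  obtain ⟨w, hw⟩ := (hasFiller_iff _).1 h
  obtain ⟨R, ht, h0, h1, -⟩ := (homotopic_iff _ _).1 hf
  have hend (ε : Bool) (m : ℕ) (a : (⟨m⟩ : Box) ⟶ ⟨n + 1⟩) (ha : OnBoundary a) :
      R.rel (a ≫ face (Fin.last (n + 1)) ε) (bdVal (f ε).map a ha) := by
    cases ε
    · exact h0 m a ha
    · exact h1 m a ha
  have key {m : ℕ} {a : (⟨m⟩ : Box) ⟶ ⟨n + 2⟩} (h1 : OnSide a)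
      (h2 : OnFace a (Fin.last (n + 1)) ε) :
      R.rel a (X.toCSet.act w (a ≫ deg (Fin.last (n + 1)))) := by
    have h3 := hend ε m _ h1.deg_last
    rwa [h2.deg_face, ← hw] at h3
  let R' : PartialCube X.toCSet (n + 2) :=
    { rel := fun {m} a x => (OnSide a ∧ R.rel a x) ∨ (OnFace a (Fin.last (n + 1)) ε ∧
        x = X.toCSet.act w (a ≫ deg (Fin.last (n + 1))))
      functional := by
        rintro m a x y (⟨h1, hx⟩ | ⟨h1, rfl⟩) (⟨h2, hy⟩ | ⟨h2, rfl⟩)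
        · exact R.functional hx hy
        · exact R.functional hx (key h1 h2)
        · exact R.functional (key h2 h1) hy
        · rfl
      stable := by
        rintro l m a x (⟨h1, hx⟩ | ⟨h1, rfl⟩) b
        · exact Or.inl ⟨h1.precomp b, R.stable hx b⟩
        · exact Or.inr ⟨h1.precomp b, by rw [act_act, Category.assoc]⟩ }
  obtain ⟨W, hW⟩ := hX.fill (Fin.last (n + 1)) (!ε) R' (by
    rintro m a ⟨j, η, hne, hj⟩
    induction j using Fin.lastCases with
    | last =>
      obtain rfl : η = ε := by
        by_contra h
        exact hne (by rw [Bool.eq_not.2 h])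
      exact ⟨_, Or.inr ⟨hj, rfl⟩⟩
    | cast j =>
      obtain ⟨x, hx⟩ := ht m a ⟨j, η, hj⟩
      exact ⟨x, Or.inl ⟨⟨j, η, hj⟩, hx⟩⟩)
  refine (hasFiller_iff _).2 ⟨X.toCSet.act W (face (Fin.last (n + 1)) !ε), fun m a ha => ?_⟩
  rw [act_act]
  have h1 := ha.face_last (!ε)
  exact hW _ _ (h1.onOpenBox _) _ (Or.inl ⟨h1, hend _ _ _ _⟩)

theorem hasFiller_iff_of_classOf_eq (hX : IsKan X.toCSet) {f g : ptBoundary n ⟶ X}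
    (h : classOf f = classOf g) : HasFiller f ↔ HasFiller g := by
  have h' := Quot.eqvGen_exact h
  induction h' with
  | rel f g hfg =>
    exact ⟨fun hf => HasFiller.of_homotopic hX (f := fun ε => bif ε then g else f) hfg
      (ε := false) hf, fun hg => HasFiller.of_homotopic hX (f := fun ε => bif ε then g else f) hfg
      (ε := true) hg⟩
  | refl f => exact Iff.rfl
  | symm f g _ ih => exact (ih (h.symm)).symm
  | trans f g k h1 h2 ih1 ih2 =>
    exact (ih1 (Quot.eqvGen_sound h1)).trans (ih2 (Quot.eqvGen_sound h2))

theorem hasFiller_boundaryMapOfLoop_pt (n : ℕ) (X : PtCSet.{u}) :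
    HasFiller (boundaryMapOfLoop n X ((iterLoop n).obj X).pt) := by
  have hg := isGlued_boundaryMapOfLoop (n := n) (X := X) ((iterLoop n).obj X).pt
  rw [loopCube_pt] at hg
  refine (hasFiller_iff _).2 ⟨X.toCSet.const X.pt (n + 1), fun m a ha => ?_⟩
  rcases ha.cases (Fin.last n) true with h | h
  · rw [hg.face _ _ h, const_act, const_act]
  · rw [hg.openBox _ _ h]

theorem homotopyGroupMk_eq_of_hasFiller {c : ((iterLoop n).obj X).toCSet.cells 0}
    (h : HasFiller (boundaryMapOfLoop n X c)) :
    homotopyGroupMk n X c = homotopyGroupMk n X ((iterLoop n).obj X).pt := by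
  have hg := isGlued_boundaryMapOfLoop c
  obtain ⟨w, hw⟩ := (hasFiller_iff _).1 h
  have key {m : ℕ} {a : (⟨m⟩ : Box) ⟶ ⟨n + 1⟩} (ha : OnOpenBox (Fin.last n) true a) :
      X.toCSet.act w a = X.toCSet.const X.pt m := by
    rw [hw _ _ ha.onBoundary, hg.openBox _ _ ha, const_act]
  -- The filler is read as a path in the last direction, from the base point at x_n = 0 to `c` at
  -- x_n = 1.
  refine (homotopyGroupMk_eq w (fun m a ha => key (ha.onOpenBox true)) ?_ ?_).symm
  · rw [loopCube_pt]
    exact key ⟨Fin.last n, false, by simp, onFace_face _ _⟩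
  · rw [hw _ _ ⟨_, _, onFace_face _ _⟩, hg.face _ _ (onFace_face _ _), face_deg, act_id]

end Glue

/-! ### Naturality, descent to π_n and the main theorem -/

theorem homotopyGroupMk_surjective (n : ℕ) (X : PtCSet.{u}) :
    Function.Surjective (homotopyGroupMk n X) := pi0Mk_surjective _

/-- Both maps are glued from the same two cubes, which determine them. -/
theorem boundaryMapOfLoop_naturality (n : ℕ) {X Y : PtCSet.{u}} (f : X ⟶ Y)
    (c : ((iterLoop n).obj X).toCSet.cells 0) :
    boundaryMapOfLoop n Y (((iterLoop n).map f).map.app _ c) = boundaryMapOfLoop n X c ≫ f := by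
  refine (isGlued_boundaryMapOfLoop _).unique ?_
  have hg := isGlued_boundaryMapOfLoop c
  rw [loopCube_naturality]
  constructor
  · intro m a ha
    refine (congrArg (f.map.app (op ⟨m⟩)) (hg.openBox m a ha)).trans ?_
    rw [naturality_act, naturality_const, f.map_pt]
  · intro m a ha
    exact (congrArg (f.map.app (op ⟨m⟩)) (hg.face m a ha)).trans (naturality_act _ _ _)

theorem exists_homotopyGroup_map (n : ℕ) (X : PtCSet.{u}) :
    ∃ G : homotopyGroup n X → Classes (ptBoundary n) X,
      ∀ c, G (homotopyGroupMk n X c) = classOf (boundaryMapOfLoop n X c) :=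
  exists_pi0_desc (fun c => classOf (boundaryMapOfLoop n X c)) fun c =>
    Quot.sound (homotopic_boundaryMapOfLoop c)

end PtCSet

theorem mainTheorem3 (n : ℕ) :
    ∃ Φ : ∀ X : PtCSet.{u}, CSet.IsKan X.toCSet →
        (PtCSet.homotopyGroup n X ≃ PtCSet.Classes (PtCSet.ptBoundary n) X),
      (∀ (X : PtCSet.{u}) (hX : CSet.IsKan X.toCSet)
          (a : ((PtCSet.iterLoop n).obj X).toCSet.cells 0),
        Φ X hX (PtCSet.homotopyGroupMk n X a) =
          PtCSet.classOf (PtCSet.boundaryMapOfLoop n X a)) ∧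
      (∀ (X Y : PtCSet.{u}) (hX : CSet.IsKan X.toCSet) (hY : CSet.IsKan Y.toCSet) (f : X ⟶ Y)
          (c : PtCSet.homotopyGroup n X),
        Φ Y hY (PtCSet.homotopyGroupMap n f c) =
          PtCSet.Classes.map (PtCSet.ptBoundary n) f (Φ X hX c)) ∧
      (∀ (X : PtCSet.{u}) (hX : CSet.IsKan X.toCSet) (f : PtCSet.ptBoundary n ⟶ X),
        (Φ X hX).symm (PtCSet.classOf f) =
            PtCSet.homotopyGroupMk n X ((PtCSet.iterLoop n).obj X).pt ↔
          PtCSet.HasFiller f) := by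
  choose G hG using PtCSet.exists_homotopyGroup_map.{u} n
  have hbij (X : PtCSet.{u}) (hX : CSet.IsKan X.toCSet) : Function.Bijective (G X) := by
    constructor
    · intro x y hxy
      obtain ⟨c, rfl⟩ := PtCSet.homotopyGroupMk_surjective n X x
      obtain ⟨d, rfl⟩ := PtCSet.homotopyGroupMk_surjective n X y
      rw [hG, hG] at hxy
      exact PtCSet.homotopyGroupMk_eq_of_eqvGen hX (Quot.eqvGen_exact hxy)
        (PtCSet.represents_boundaryMapOfLoop c) (PtCSet.represents_boundaryMapOfLoop d)
    · rintro ⟨f⟩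
      obtain ⟨c, hc⟩ := PtCSet.exists_represents hX f
      exact ⟨PtCSet.homotopyGroupMk n X c, (hG X c).trans hc.classOf_eq.symm⟩
  refine ⟨fun X hX => Equiv.ofBijective (G X) (hbij X hX), fun X hX => hG X,
    fun X Y hX hY f c => ?_, fun X hX f => ?_⟩
  · obtain ⟨c, rfl⟩ := PtCSet.homotopyGroupMk_surjective n X c
    change G Y (PtCSet.homotopyGroupMap n f (PtCSet.homotopyGroupMk n X c)) =
      PtCSet.Classes.map (PtCSet.ptBoundary n) f (G X (PtCSet.homotopyGroupMk n X c))
    have h1 : PtCSet.homotopyGroupMap n f (PtCSet.homotopyGroupMk n X c) =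
        PtCSet.homotopyGroupMk n Y (((PtCSet.iterLoop n).map f).map.app _ c) :=
      CSet.pi0Map_pi0Mk _ _
    rw [h1, hG, hG, PtCSet.boundaryMapOfLoop_naturality]
    rfl
  -- The left side now says that `f` has the class of the map given by the base point of Ω^n, which
  -- has a constant filler.
  · rw [Equiv.symm_apply_eq, Equiv.ofBijective_apply, hG]
    constructor
    · intro h
      exact (PtCSet.hasFiller_iff_of_classOf_eq hX h).2
        (PtCSet.hasFiller_boundaryMapOfLoop_pt n X)
    · intro h
      -- The filler is transported to the map of a representative, where it becomes a path from the
      -- base point to `c`.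
      obtain ⟨c, hc⟩ := PtCSet.exists_represents hX f
      rw [hc.classOf_eq, ← hG, ← hG, PtCSet.homotopyGroupMk_eq_of_hasFiller
        ((PtCSet.hasFiller_iff_of_classOf_eq hX hc.classOf_eq).1 h)]
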